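/- **Definitions.** An ordered group is a pair $(G,G^+)$ of a countable abelian group $G$ and a subset $G^+\subseteq G$ with $G^++G^+\subseteq G^+$, $G^+\cap(-G^+)=\{0\}$ and $G^+-G^+=G$. It is a *simple dimension group* if there are integers $d_i\ge 1$ and $d_{i+1}\times d_i$ matrices $A_i$ with strictly positive integer entries ($i\ge 0$) and a group isomorphism from $G$ onto the inductive limit $\varinjlim_i(\mathbb Z^{d_i},A_i)$ that carries $G^+$ onto the set of classes of vectors with nonnegative entries. An *order unit* is an element $u\in G^+$ such that for every $a\in G$ there is an integer $k\ge 0$ with $ku-a\in G^+$; then $(G,G^+,u)$ is a *simple dimension group with unit*. Two triples $(G,G^+,u)$ and $(H,H^+,v)$ are *isomorphic as ordered groups with unit* if some group isomorphism $\varphi:G\to H$ satisfies $\varphi(G^+)=H^+$ and $\varphi(u)=v$. For a finite alphabet $\mathcal A$, a subshift $(Y,S)$ is a closed shift-invariant set $Y\subseteq\mathcal A^{\mathbb Z}$ with the shift $S((x_i)_i)=(x_{i+1})_i$; it is *minimal* if $Y\neq\emptyset$ and its only closed $S$-invariant subsets are $\emptyset$ and $Y$. Its complexity $p_Y(n)$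 is the number of words of length $n$ that occur in elements of $Y$. It is a *Toeplitz subshift* if $Y$ is the closure of the shift orbit of a sequence $x\in\mathcal A^{\mathbb Z}$ such that for every $i\in\mathbb Z$ there is an integer $p\ge 1$ with $x_{i+kp}=x_i$ for all $k\in\mathbb Z$. Finally $K^0(Y,S)=(H,H^+,[1])$, where $H=C(Y,\mathbb Z)/\{f\circ S-f: f\in C(Y,\mathbb Z)\}$, $H^+$ is the set of classes of nonnegative functions, and $[1]$ is the class of the constant function $1$. **Theorem.** Let $(G,G^+,u)$ be a simple dimension group with unit such that $G$ is divisible (for all $g\in G$ and $k\ge 1$ there is $h\in G$ with $kh=g$), and let $(p_n)_{n\in\mathbb N}$ be a sequence of positive real numbers with $\lim_{n\to\infty} n/p_n=0$. Then there exists a minimal Toeplitz subshift $(Y,S)$ on a finite alphabet such that 1. $K^0(Y,S)$ and $(G,G^+,u)$ are isomorphic as ordered groups with unit; 2. $\lim_{n\to\infty} p_Y(n)/p_n=0$. -/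

import Mathlib

namespace DimToeplitz

/-! ### Ordered groups, order units, simple dimension groups -/

/-- `(G, P)` is an ordered group: `G` is a countable abelian group and
`P + P ⊆ P`, `P ∩ (-P) = {0}`, `P - P = G`. -/
structure IsOrderedGroup (G : Type*) [AddCommGroup G] (P : Set G) : Prop where
  countable : Countable G
  add_mem : ∀ a ∈ P, ∀ b ∈ P, a + b ∈ P
  inter_neg : {a : G | a ∈ P ∧ -a ∈ P} = {0}
  sub_eq : ∀ g : G, ∃ a ∈ P, ∃ b ∈ P, g = a - b

/-- `u` is an order unit for the positive cone `P`; here `a ≤ b` means `b - a ∈ P`. -/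
def IsOrderUnit {G : Type*} [AddCommGroup G] (P : Set G) (u : G) : Prop :=
  u ∈ P ∧ ∀ a : G, ∃ k : ℕ, k • u - a ∈ P

/-- The composition `A_{j-1} ⋯ A_i : ℤ^{d_i} → ℤ^{d_j}` for `i ≤ j`. -/
def transition {d : ℕ → ℕ} (A : ∀ i, Matrix (Fin (d (i + 1))) (Fin (d i)) ℤ)
    (i j : ℕ) (h : i ≤ j) : (Fin (d i) → ℤ) →+ (Fin (d j) → ℤ) :=
  Nat.leRec (motive := fun j _ => (Fin (d i) → ℤ) →+ (Fin (d j) → ℤ))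
    (AddMonoidHom.id _) (fun k _ g => (A k).mulVecLin.toAddMonoidHom.comp g) h

/-- The inductive limit of `ℤ^{d_0} → ℤ^{d_1} → ℤ^{d_2} → ⋯` along the matrices `A_i`. -/
abbrev IndLim {d : ℕ → ℕ} (A : ∀ i, Matrix (Fin (d (i + 1))) (Fin (d i)) ℤ) : Type :=
  AddCommGroup.DirectLimit (fun i => Fin (d i) → ℤ) (transition A)

/-- The positive cone of the induced order: classes `[x, i]` of vectors `x ∈ ℤ^{d_i}` with
nonnegative entries. -/
def indLimPos {d : ℕ → ℕ} (A : ∀ i, Matrix (Fin (d (i + 1))) (Fin (d i)) ℤ) : Set (IndLim A) :=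
  {z | ∃ (i : ℕ) (x : Fin (d i) → ℤ), 0 ≤ x ∧
    AddCommGroup.DirectLimit.of (fun i => Fin (d i) → ℤ) (transition A) i x = z}

/-- `(G, P)` is a simple dimension group: an ordered group isomorphic, as an ordered group, to an
inductive limit of groups `ℤ^{d_i}`, `d_i ≥ 1`, along matrices with strictly positive integer
entries. -/
structure IsSimpleDimensionGroup (G : Type*) [AddCommGroup G] (P : Set G) : Prop where
  ordered : IsOrderedGroup G P
  exists_limit : ∃ (d : ℕ → ℕ) (A : ∀ i, Matrix (Fin (d (i + 1))) (Fin (d i)) ℤ),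
    (∀ i, 1 ≤ d i) ∧ (∀ i k l, 0 < A i k l) ∧
      ∃ φ : G ≃+ IndLim A, φ '' P = indLimPos A

/-- `(G, P, u)` is a simple dimension group with unit. -/
structure IsSimpleDimensionGroupWithUnit (G : Type*) [AddCommGroup G] (P : Set G) (u : G) :
    Prop where
  simple : IsSimpleDimensionGroup G P
  unit : IsOrderUnit P u

/-- `(G, P, u)` and `(H, Q, v)` are isomorphic as ordered groups with unit. -/
def OrderedGroupIso {G H : Type*} [AddCommGroup G] [AddCommGroup H]
    (P : Set G) (u : G) (Q : Set H) (v : H) : Prop :=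
  ∃ φ : G ≃+ H, φ '' P = Q ∧ φ u = v

/-! ### Dynamical systems and the dynamical dimension group `K⁰(X, T)` -/

section Dynamics

variable {X : Type*} [TopologicalSpace X]

/-- `(X, T)` is minimal: `X` is nonempty and has no closed `T`-invariant subsets other than `∅`
and `X`. -/
def IsMinimalSystem (T : X ≃ₜ X) : Prop :=
  Nonempty X ∧ ∀ C : Set X, IsClosed C → T '' C = C → C = ∅ ∨ C = Set.univ

/-- The coboundary map `f ↦ f ∘ T - f` on `C(X, ℤ)`. -/
def coboundary (T : X ≃ₜ X) : C(X, ℤ) →+ C(X, ℤ) where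
  toFun f := f.comp (T : C(X, X)) - f
  map_zero' := by ext; simp
  map_add' f g := by ext; simp; ring

/-- `H(X, T) = C(X, ℤ) / β C(X, ℤ)`. -/
abbrev DynH (T : X ≃ₜ X) : Type _ := C(X, ℤ) ⧸ (coboundary T).range

/-- `H⁺(X, T)`: the classes of nonnegative functions. -/
def dynHPos (T : X ≃ₜ X) : Set (DynH T) :=
  {z | ∃ f : C(X, ℤ), (∀ x, 0 ≤ f x) ∧ (QuotientAddGroup.mk f : DynH T) = z}

/-- The class of the constant function `1`. -/
def dynHUnit (T : X ≃ₜ X) : DynH T :=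
  QuotientAddGroup.mk (ContinuousMap.const X (1 : ℤ))

end Dynamics

/-! ### Subshifts, complexity, Toeplitz subshifts -/

open SymbolicDynamics.FullShift

section Subshifts

variable {α : Type*} [TopologicalSpace α]

/-- The shift `(x_i) ↦ (x_{i+1})` restricted to a subshift `Y ⊆ α^ℤ`. -/
def shiftHomeo (Y : Subshift α ℤ) : Y.carrier ≃ₜ Y.carrier where
  toFun x := ⟨shift 1 x.1, Y.mapsTo 1 x.2⟩
  invFun x := ⟨shift (-1) x.1, Y.mapsTo (-1) x.2⟩
  left_inv x := by ext i; simp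
  right_inv x := by ext i; simp
  continuous_toFun := by fun_prop
  continuous_invFun := by fun_prop

/-- The words of length `n` in the language of `Y`. -/
def languageOfLength (Y : Subshift α ℤ) (n : ℕ) : Set (Fin n → α) :=
  {w | ∃ x ∈ Y.carrier, ∃ i : ℤ, ∀ j : Fin n, w j = x (i + (j : ℕ))}

/-- The factor complexity `p_Y(n)`. -/
noncomputable def complexity (Y : Subshift α ℤ) (n : ℕ) : ℕ :=
  (languageOfLength Y n).ncard

/-- A Toeplitz sequence: every position belongs to an arithmetic progression, of period `p ≥ 1`,
along which the sequence is constant. -/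
def IsToeplitzSeq {β : Type*} (x : ℤ → β) : Prop :=
  ∀ i : ℤ, ∃ p : ℕ, 1 ≤ p ∧ ∀ k : ℤ, x i = x (i + k * p)

/-- A Toeplitz subshift is the orbit closure of a Toeplitz sequence. -/
def IsToeplitzSubshift (Y : Subshift α ℤ) : Prop :=
  ∃ x : ℤ → α, IsToeplitzSeq x ∧ Y.carrier = closure (Set.range fun k : ℤ => shift k x)

end Subshifts

/-! ### Presentations of ordered groups by nonnegative integer matrices -/

/-- The action of a matrix of natural numbers on integer vectors. -/
def natMulVec {a b : ℕ} (M : Fin a → Fin b → ℕ) : (Fin b → ℤ) →+ (Fin a → ℤ) where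
  toFun v k := ∑ l, (M k l : ℤ) * v l
  map_zero' := by ext; simp
  map_add' v w := by ext; simp [mul_add, Finset.sum_add_distrib]

lemma natMulVec_apply {a b : ℕ} (M : Fin a → Fin b → ℕ) (v : Fin b → ℤ) (k : Fin a) :
    natMulVec M v k = ∑ l, (M k l : ℤ) * v l := rfl

lemma natMulVec_nonneg {a b : ℕ} (M : Fin a → Fin b → ℕ) {v : Fin b → ℤ} (hv : 0 ≤ v) :
    0 ≤ natMulVec M v := fun k => by
  rw [natMulVec_apply]
  exact Finset.sum_nonneg fun l _ => mul_nonneg (Int.natCast_nonneg _) (hv l)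

/-- The vector `v` at level `i` is sent to `0` by finitely many of the matrices. -/
inductive Vanishes {d : ℕ → ℕ} (M : ∀ i, Fin (d (i + 1)) → Fin (d i) → ℕ) :
    ∀ i, (Fin (d i) → ℤ) → Prop
  | zero (i : ℕ) : Vanishes M i 0
  | step (i : ℕ) (v : Fin (d i) → ℤ) : Vanishes M (i + 1) (natMulVec (M i) v) → Vanishes M i v

/-- The homomorphisms `γ i : ℤ^{d i} → G` exhibit `(G, P)` as the ordered inductive limit of
the system given by the matrices `M i`. -/
structure IsPresentation {G : Type*} [AddCommGroup G] (P : Set G) {d : ℕ → ℕ}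
    (M : ∀ i, Fin (d (i + 1)) → Fin (d i) → ℕ) (γ : ∀ i, (Fin (d i) → ℤ) →+ G) : Prop where
  compat : ∀ i v, γ (i + 1) (natMulVec (M i) v) = γ i v
  surj : ∀ g, ∃ i v, γ i v = g
  vanishes : ∀ i v, γ i v = 0 → Vanishes M i v
  mem_iff : ∀ g, g ∈ P ↔ ∃ i v, 0 ≤ v ∧ γ i v = g

lemma Vanishes.not_pos {d : ℕ → ℕ} {M : ∀ i, Fin (d (i + 1)) → Fin (d i) → ℕ}
    (hd : ∀ i, 1 ≤ d i) (hM : ∀ i k l, 0 < M i k l) {i : ℕ} {v : Fin (d i) → ℤ}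
    (h : Vanishes M i v) : ¬ ∀ k, 0 < v k := by
  induction h with
  | zero i => exact fun h => lt_irrefl _ (h ⟨0, hd i⟩)
  | step i v _ ih =>
    intro hv
    refine ih fun k => ?_
    rw [natMulVec_apply]
    refine Finset.sum_pos (fun l _ => ?_) ⟨⟨0, hd i⟩, Finset.mem_univ _⟩
    exact mul_pos (by exact_mod_cast hM i k l) (hv l)

namespace IsPresentation

variable {G : Type*} [AddCommGroup G] {P : Set G} {d : ℕ → ℕ}
  {M : ∀ i, Fin (d (i + 1)) → Fin (d i) → ℕ} {γ : ∀ i, (Fin (d i) → ℤ) →+ G}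

lemma exists_lift (h : IsPresentation P M γ) {i j : ℕ} (hij : i ≤ j) (v : Fin (d i) → ℤ) :
    ∃ w : Fin (d j) → ℤ, γ j w = γ i v ∧ (0 ≤ v → 0 ≤ w) := by
  induction j, hij using Nat.le_induction with
  | base => exact ⟨v, rfl, id⟩
  | succ j _ ih =>
    obtain ⟨w, hw, hw'⟩ := ih
    exact ⟨natMulVec (M j) w, (h.compat j w).trans hw, fun hv => natMulVec_nonneg _ (hw' hv)⟩

lemma torsion_free (h : IsPresentation P M γ) {n : ℕ} (hn : n ≠ 0) {g : G}
    (hg : n • g = 0) : g = 0 := by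
  obtain ⟨i, v, rfl⟩ := h.surj g
  rw [← map_nsmul] at hg
  have key : ∀ i (r : Fin (d i) → ℤ), Vanishes M i r → ∀ v, n • v = r → γ i v = 0 := by
    intro i r hr
    induction hr with
    | zero i =>
      intro v hv
      rw [(smul_eq_zero.1 hv).resolve_left hn, map_zero]
    | step i r _ ih =>
      intro v hv
      rw [← h.compat]
      exact ih _ (by rw [← map_nsmul, hv])
  exact key i _ (h.vanishes _ _ hg) v rfl

lemma unperforated (h : IsPresentation P M γ) {n : ℕ} (hn : n ≠ 0) {g : G}
    (hg : n • g ∈ P) : g ∈ P := by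
  obtain ⟨i, v, rfl⟩ := h.surj g
  obtain ⟨i', w, hw, hwg⟩ := (h.mem_iff _).1 hg
  have key : ∀ i (r : Fin (d i) → ℤ), Vanishes M i r →
      ∀ v w, 0 ≤ w → n • v - w = r → γ i v ∈ P := by
    intro i r hr
    induction hr with
    | zero i =>
      intro v w hw hv
      refine (h.mem_iff _).2 ⟨i, v, fun k => ?_, rfl⟩
      have h1 : (n : ℤ) * v k = w k := by
        have := congrFun hv k
        simp at this
        linarith
      have h2 : 0 ≤ (n : ℤ) * v k := h1 ▸ hw k
      exact nonneg_of_mul_nonneg_right h2 (by positivity)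
    | step i r _ ih =>
      intro v w hw hv
      rw [← h.compat]
      exact ih _ (natMulVec (M i) w) (natMulVec_nonneg _ hw)
        (by rw [← map_nsmul, ← map_sub, hv])
  obtain ⟨v', hv', -⟩ := h.exists_lift (le_max_left i i') v
  obtain ⟨w', hw', hw0⟩ := h.exists_lift (le_max_right i i') w
  rw [← hv'] at hwg ⊢
  refine key _ _ (h.vanishes _ (n • v' - w') ?_) v' w' (hw0 hw) rfl
  rw [map_sub, map_nsmul, hw', hwg, sub_self]

lemma shift_levels (h : IsPresentation P M γ) (n : ℕ) :
    IsPresentation P (d := fun i => d (n + i)) (fun i => M (n + i)) (fun i => γ (n + i)) where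
  compat i v := h.compat (n + i) v
  surj g := by
    obtain ⟨i, v, rfl⟩ := h.surj g
    obtain ⟨w, hw, -⟩ := h.exists_lift (Nat.le_add_left i n) v
    exact ⟨i, w, hw⟩
  vanishes i v hv := by
    have key : ∀ j (r : Fin (d j) → ℤ), Vanishes M j r → ∀ i (e : n + i = j)
        (v : Fin (d (n + i)) → ℤ), HEq v r →
        Vanishes (d := fun i => d (n + i)) (fun i => M (n + i)) i v := by
      intro j r hr
      induction hr with
      | zero j =>
        rintro i rfl v hv
        rw [eq_of_heq hv]
        exact Vanishes.zero i
      | step j r _ ih =>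
        rintro i rfl v hv
        rw [eq_of_heq hv]
        exact Vanishes.step i _ (ih (i + 1) rfl _ HEq.rfl)
    exact key _ _ (h.vanishes _ _ hv) i rfl v HEq.rfl
  mem_iff g := by
    rw [h.mem_iff]
    constructor
    · rintro ⟨i, v, hv, rfl⟩
      obtain ⟨w, hw, hw0⟩ := h.exists_lift (Nat.le_add_left i n) v
      exact ⟨i, w, hw0 hv, hw⟩
    · rintro ⟨i, v, hv, rfl⟩
      exact ⟨n + i, v, hv, rfl⟩

end IsPresentation

/-! ### Presentations of simple dimension groups -/

lemma transition_self {d : ℕ → ℕ} (A : ∀ i, Matrix (Fin (d (i + 1))) (Fin (d i)) ℤ) (i : ℕ)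
    (v : Fin (d i) → ℤ) : transition A i i le_rfl v = v := by
  simp [transition]

lemma transition_succ {d : ℕ → ℕ} (A : ∀ i, Matrix (Fin (d (i + 1))) (Fin (d i)) ℤ) {i j : ℕ}
    (h : i ≤ j) (v : Fin (d i) → ℤ) :
    transition A i (j + 1) (Nat.le_succ_of_le h) v = (A j).mulVec (transition A i j h v) := by
  rw [transition, Nat.leRec_succ _ _ h]
  rfl

lemma transition_trans {d : ℕ → ℕ} (A : ∀ i, Matrix (Fin (d (i + 1))) (Fin (d i)) ℤ) {i j k : ℕ}
    (hij : i ≤ j) (hjk : j ≤ k) (v : Fin (d i) → ℤ) :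
    transition A j k hjk (transition A i j hij v) = transition A i k (hij.trans hjk) v := by
  induction k, hjk using Nat.le_induction with
  | base => exact transition_self A j _
  | succ k hjk ih => rw [transition_succ A hjk, ih, transition_succ A (hij.trans hjk)]

lemma directedSystem_transition {d : ℕ → ℕ}
    (A : ∀ i, Matrix (Fin (d (i + 1))) (Fin (d i)) ℤ) :
    DirectedSystem (fun i => Fin (d i) → ℤ) fun i j h => transition A i j h where
  map_self _ v := transition_self A _ v
  map_map _ _ _ hij hjk v := transition_trans A hij hjk v

lemma exists_presentation {G : Type*} [AddCommGroup G] {P : Set G}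
    (hG : IsSimpleDimensionGroup G P) :
    ∃ (d : ℕ → ℕ) (M : ∀ i, Fin (d (i + 1)) → Fin (d i) → ℕ) (γ : ∀ i, (Fin (d i) → ℤ) →+ G),
      (∀ i, 1 ≤ d i) ∧ (∀ i k l, 0 < M i k l) ∧ IsPresentation P M γ := by
  obtain ⟨d, A, hd, hA, φ, hφ⟩ := hG.exists_limit
  have hact : ∀ i v, natMulVec (fun k l => (A i k l).toNat) v = (A i).mulVec v := by
    intro i v
    ext k
    rw [natMulVec_apply, Matrix.mulVec, dotProduct]
    exact Finset.sum_congr rfl fun l _ => by rw [Int.toNat_of_nonneg (hA i k l).le]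
  let ι := fun i => AddCommGroup.DirectLimit.of (fun i => Fin (d i) → ℤ) (transition A) i
  refine ⟨d, fun i k l => (A i k l).toNat, fun i => φ.symm.toAddMonoidHom.comp (ι i), hd,
    fun i k l => Int.lt_toNat.2 (hA i k l), ?_, ?_, ?_, ?_⟩
  · intro i v
    have : transition A i (i + 1) (Nat.le_succ i) v = (A i).mulVec v := by
      rw [transition_succ A le_rfl, transition_self]
    rw [hact, ← this]
    exact congrArg φ.symm (AddCommGroup.DirectLimit.of_f (f := transition A) (Nat.le_succ i) v)
  · intro g
    obtain ⟨z, rfl⟩ := φ.symm.surjective g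
    induction z using AddCommGroup.DirectLimit.induction_on with
    | ih i v => exact ⟨i, v, rfl⟩
  · intro i v hv
    have := directedSystem_transition A
    have hv' : ι i v = 0 := φ.symm.injective (hv.trans (map_zero φ.symm).symm)
    obtain ⟨j, hij, hj⟩ := AddCommGroup.DirectLimit.of.zero_exact (G := fun i => Fin (d i) → ℤ)
      (f := transition A) i v hv'
    have key : ∀ j (hij : i ≤ j), Vanishes (fun i k l => (A i k l).toNat) j
        (transition A i j hij v) → Vanishes (fun i k l => (A i k l).toNat) i v := by
      intro j hij
      induction j, hij using Nat.le_induction with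
      | base => rw [transition_self]; exact id
      | succ j hij ih =>
        intro h
        refine ih (Vanishes.step _ _ ?_)
        rwa [hact, ← transition_succ]
    exact key j hij (hj ▸ Vanishes.zero j)
  · intro g
    have : g ∈ P ↔ φ g ∈ indLimPos A := by
      rw [← hφ, φ.injective.mem_set_image]
    rw [this]
    constructor
    · rintro ⟨i, v, hv, h⟩
      exact ⟨i, v, hv, (φ.symm_apply_eq).2 h⟩
    · rintro ⟨i, v, hv, h⟩
      exact ⟨i, v, hv, (φ.symm_apply_eq).1 h⟩

/-- A simple dimension group with unit has a presentation in which the unit is a strictly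
positive vector at level `0`. -/
lemma exists_presentation_unit {G : Type*} [AddCommGroup G] {P : Set G} {u : G}
    (hG : IsSimpleDimensionGroupWithUnit G P u) :
    ∃ (d : ℕ → ℕ) (M : ∀ i, Fin (d (i + 1)) → Fin (d i) → ℕ) (γ : ∀ i, (Fin (d i) → ℤ) →+ G)
      (x : Fin (d 0) → ℕ), (∀ i, 1 ≤ d i) ∧ (∀ i k l, 0 < M i k l) ∧ IsPresentation P M γ ∧
      (∀ k, 0 < x k) ∧ γ 0 (fun k => (x k : ℤ)) = u := by
  obtain ⟨d, M, γ, hd, hM, h⟩ := exists_presentation hG.simple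
  obtain ⟨i, v, hv, hu⟩ := (h.mem_iff u).1 hG.unit.1
  have hne : v ≠ 0 := by
    rintro rfl
    rw [map_zero] at hu
    have hP : ∀ a : G, -a ∈ P := fun a => by
      obtain ⟨k, hk⟩ := hG.unit.2 a
      rwa [← hu, smul_zero, zero_sub] at hk
    have h0 : ∀ a : G, a = 0 := fun a => by
      have : a ∈ {a : G | a ∈ P ∧ -a ∈ P} := ⟨by simpa using hP (-a), hP a⟩
      rwa [hG.simple.ordered.inter_neg] at this
    exact (h.vanishes 0 (fun _ => 1) (h0 _)).not_pos hd hM fun _ => one_pos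
  obtain ⟨l, hl⟩ : ∃ l, 0 < v l := by
    by_contra! hc
    exact hne (funext fun l => le_antisymm (hc l) (hv l))
  have hpos : ∀ k, 0 < natMulVec (M i) v k := fun k => by
    rw [natMulVec_apply]
    refine Finset.sum_pos' (fun l _ => mul_nonneg (Int.natCast_nonneg _) (hv l))
      ⟨l, Finset.mem_univ _, mul_pos (by exact_mod_cast hM i k l) hl⟩
  refine ⟨fun j => d (i + 1 + j), fun j => M (i + 1 + j), fun j => γ (i + 1 + j),
    fun k => (natMulVec (M i) v k).toNat, fun j => hd _, fun j => hM _, h.shift_levels (i + 1),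
    fun k => Int.lt_toNat.2 (hpos k), ?_⟩
  have : (fun k => ((natMulVec (M i) v k).toNat : ℤ)) = natMulVec (M i) v :=
    funext fun k => Int.toNat_of_nonneg (hpos k).le
  exact (congrArg (γ (i + 1)) this).trans ((h.compat i v).trans hu)

/-! ### Presentations with constant row sums -/

lemma sum_fin_mul_two {β : Type*} [AddCommMonoid β] {d : ℕ} (f : Fin (d * 2) → β) :
    ∑ L, f L = ∑ l, ∑ s, f (finProdFinEquiv (l, s)) := by
  rw [← finProdFinEquiv.sum_comp, Fintype.sum_prod_type]

/-- The coordinate of `Fin d` underlying an element of its double `Fin (d * 2)`. -/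
def undouble {d : ℕ} (L : Fin (d * 2)) : Fin d := (finProdFinEquiv.symm L).1

@[simp] lemma undouble_apply {d : ℕ} (l : Fin d) (s : Fin 2) :
    undouble (finProdFinEquiv (l, s)) = l := by
  simp [undouble]

/-- Add up the two copies of each coordinate and multiply by the weights `x`. -/
def weightedCollapse {d : ℕ} (x : Fin d → ℕ) : (Fin (d * 2) → ℤ) →+ (Fin d → ℤ) where
  toFun v k := x k * ∑ s, v (finProdFinEquiv (k, s))
  map_zero' := by ext; simp
  map_add' v w := by ext; simp; ring

lemma weightedCollapse_apply {d : ℕ} (x : Fin d → ℕ) (v : Fin (d * 2) → ℤ) (k : Fin d) :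
    weightedCollapse x v k = x k * ∑ s, v (finProdFinEquiv (k, s)) := rfl

/-- The weights `x i` obtained by transporting the vector `x₀` along the matrices `M i`. -/
def weights {d : ℕ → ℕ} (M : ∀ i, Fin (d (i + 1)) → Fin (d i) → ℕ) (x₀ : Fin (d 0) → ℕ) :
    ∀ i, Fin (d i) → ℕ
  | 0 => x₀
  | i + 1 => fun k => ∑ l, M i k l * weights M x₀ i l

/-- The matrix `M` conjugated by the weights `x` and `x'`, with denominators cleared, multiplied
by `t`, and acting on doubled coordinates. -/
def balancedMatrix {a b : ℕ} (M : Fin a → Fin b → ℕ) (x : Fin b → ℕ) (x' : Fin a → ℕ) (t : ℕ)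
    (K : Fin (a * 2)) (L : Fin (b * 2)) : ℕ :=
  t * (M (undouble K) (undouble L) * x (undouble L) *
    ∏ k ∈ Finset.univ.erase (undouble K), x' k)

section balanced

variable {a b : ℕ} {M : Fin a → Fin b → ℕ} {x : Fin b → ℕ} {x' : Fin a → ℕ} {t : ℕ}

lemma balancedMatrix_ge (hM : ∀ k l, 0 < M k l) (hx : ∀ l, 0 < x l) (hx' : ∀ k, 0 < x' k)
    (K : Fin (a * 2)) (L : Fin (b * 2)) : t ≤ balancedMatrix M x x' t K L :=
  Nat.le_mul_of_pos_right t
    (Nat.mul_pos (Nat.mul_pos (hM _ _) (hx _)) (Finset.prod_pos fun k _ => hx' k))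

lemma sum_balancedMatrix (hxx : ∀ k, x' k = ∑ l, M k l * x l) (K : Fin (a * 2)) :
    ∑ L, balancedMatrix M x x' t K L = 2 * (∏ k, x' k) * t := by
  rw [sum_fin_mul_two]
  simp only [balancedMatrix, undouble_apply, Finset.sum_const, Finset.card_univ, Fintype.card_fin,
    smul_eq_mul, ← Finset.mul_sum, ← Finset.sum_mul]
  rw [← hxx, Finset.mul_prod_erase _ _ (Finset.mem_univ _)]
  ring

lemma weight_mul_balancedMatrix (v : Fin (b * 2) → ℤ) (K : Fin (a * 2)) :
    (x' (undouble K) : ℤ) * natMulVec (balancedMatrix M x x' t) v K =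
      t * (∏ k, x' k : ℕ) * natMulVec M (weightedCollapse x v) (undouble K) := by
  rw [natMulVec_apply, natMulVec_apply, sum_fin_mul_two,
    ← Finset.mul_prod_erase _ _ (Finset.mem_univ (undouble K))]
  simp only [balancedMatrix, undouble_apply, weightedCollapse_apply, Finset.mul_sum]
  refine Finset.sum_congr rfl fun l _ => Finset.sum_congr rfl fun s _ => ?_
  push_cast
  ring

lemma weightedCollapse_balancedMatrix (v : Fin (b * 2) → ℤ) :
    weightedCollapse x' (natMulVec (balancedMatrix M x x' t) v) =
      (2 * (∏ k, x' k) * t) • natMulVec M (weightedCollapse x v) := by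
  ext k
  rw [weightedCollapse_apply, Finset.mul_sum]
  have : ∀ s, (x' k : ℤ) * natMulVec (balancedMatrix M x x' t) v (finProdFinEquiv (k, s)) =
      t * (∏ k, x' k : ℕ) * natMulVec M (weightedCollapse x v) k := fun s => by
    have := weight_mul_balancedMatrix (M := M) (x := x) (x' := x') (t := t) v
      (finProdFinEquiv (k, s))
    rwa [undouble_apply] at this
  rw [Finset.sum_congr rfl fun s _ => this s]
  simp
  ring

end balanced

/-- A divisible simple dimension group with unit has, for every choice of lower bounds `t i`, a
presentation by matrices with constant row sums `K i * t i` and entries at least `t i`, where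
`K i` and the sizes of the matrices do not depend on `t`. The unit is the vector `(1, …, 1)` at
level `0`. -/
theorem exists_balanced_presentation {G : Type*} [AddCommGroup G] {P : Set G} {u : G}
    (hG : IsSimpleDimensionGroupWithUnit G P u)
    (hdiv : ∀ (g : G) (k : ℕ), 1 ≤ k → ∃ h : G, k • h = g) :
    ∃ d K : ℕ → ℕ, (∀ i, 2 ≤ d i) ∧ (∀ i, 1 ≤ K i) ∧ ∀ t : ℕ → ℕ, (∀ i, 1 ≤ t i) →
      ∃ (B : ∀ i, Fin (d (i + 1)) → Fin (d i) → ℕ) (γ : ∀ i, (Fin (d i) → ℤ) →+ G),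
        (∀ i k l, t i ≤ B i k l) ∧ (∀ i k, ∑ l, B i k l = K i * t i) ∧
        IsPresentation P B γ ∧ γ 0 (fun _ => 1) = u := by
  obtain ⟨d, M, γ, x₀, hd, hM, h, hx₀, hu⟩ := exists_presentation_unit hG
  set x := weights M x₀ with hx
  have hxx : ∀ i k, x (i + 1) k = ∑ l, M i k l * x i l := fun i k => rfl
  have hxpos : ∀ i k, 0 < x i k := by
    intro i
    induction i with
    | zero => exact hx₀
    | succ i ih =>
      intro k
      rw [hxx]
      exact Finset.sum_pos (fun l _ => Nat.mul_pos (hM i k l) (ih l))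
        ⟨⟨0, hd i⟩, Finset.mem_univ _⟩
  refine ⟨fun i => d i * 2, fun i => 2 * ∏ k, x (i + 1) k, fun i => ?_, fun i => ?_,
    fun t ht => ?_⟩
  · exact Nat.mul_le_mul_right 2 (hd i)
  · exact Nat.mul_pos two_pos (Finset.prod_pos fun k _ => hxpos _ k)
  set m : ℕ → ℕ := fun i => 2 * (∏ k, x (i + 1) k) * t i
  have hmpos : ∀ i, 0 < m i := fun i =>
    Nat.mul_pos (Nat.mul_pos two_pos (Finset.prod_pos fun k _ => hxpos _ k)) (ht i)
  set H : ℕ → ℕ := fun i => ∏ j ∈ Finset.range i, m j with hH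
  have hHpos : ∀ i, 2 * H i ≠ 0 := fun i =>
    mul_ne_zero two_ne_zero (Finset.prod_pos fun j _ => hmpos j).ne'
  have hHsucc : ∀ i, H (i + 1) = H i * m i := fun i => Finset.prod_range_succ _ _
  let δ : ∀ n : ℕ, n ≠ 0 → G ≃+ G := fun n hn =>
    AddEquiv.ofBijective (nsmulAddMonoidHom n)
      ⟨(injective_iff_map_eq_zero _).2 fun g hg => h.torsion_free hn hg,
        fun g => hdiv g n (Nat.one_le_iff_ne_zero.2 hn)⟩
  have hδ : ∀ n hn g, n • (δ n hn).symm g = g := fun n hn g => (δ n hn).apply_symm_apply g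
  have hcancel : ∀ n : ℕ, n ≠ 0 → ∀ g g' : G, n • g = n • g' → g = g' := fun n hn g g' e =>
    (δ n hn).injective e
  let B : ∀ i, Fin (d (i + 1) * 2) → Fin (d i * 2) → ℕ := fun i =>
    balancedMatrix (M i) (x i) (x (i + 1)) (t i)
  let ε : ∀ i, (Fin (d i * 2) → ℤ) →+ G := fun i =>
    (δ (2 * H i) (hHpos i)).symm.toAddMonoidHom.comp ((γ i).comp (weightedCollapse (x i)))
  have hε : ∀ i v, (2 * H i) • ε i v = γ i (weightedCollapse (x i) v) := fun i v =>
    hδ (2 * H i) (hHpos i) _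
  have hcompat : ∀ i v, ε (i + 1) (natMulVec (B i) v) = ε i v := by
    intro i v
    refine hcancel _ (hHpos (i + 1)) _ _ ?_
    rw [hε, hHsucc, ← mul_assoc, mul_comm _ (m i), mul_smul (m i), hε,
      weightedCollapse_balancedMatrix, map_nsmul, h.compat]
  have hsurj : ∀ i y, 0 < i → ∃ v, ε i v = γ i y ∧ (0 ≤ y → 0 ≤ v) := by
    intro i y hi
    obtain ⟨i, rfl⟩ := Nat.exists_eq_succ_of_ne_zero hi.ne'
    have hdvd : ∀ k, ∃ c, 2 * H (i + 1) = x (i + 1) k * c := fun k =>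
      ((((Finset.dvd_prod_of_mem _ (Finset.mem_univ k)).mul_left 2).mul_right (t i)).mul_left
        (H i) |>.trans (hHsucc i).symm.dvd).mul_left 2
    choose c hc using hdvd
    refine ⟨fun L => if (finProdFinEquiv.symm L).2 = 0 then c (undouble L) * y (undouble L)
      else 0, hcancel _ (hHpos (i + 1)) _ _ ?_, fun hy L => ?_⟩
    · rw [hε, ← map_nsmul]
      congr 1
      ext k
      rw [weightedCollapse_apply]
      simp only [Equiv.symm_apply_apply, undouble_apply, Fin.sum_univ_two, Pi.smul_apply]
      rw [hc k]
      simp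
      ring
    · have := hy (undouble L)
      simp only [Pi.zero_apply] at this ⊢
      split_ifs
      · positivity
      · exact le_rfl
  refine ⟨B, ε, fun i K L => balancedMatrix_ge (hM i) (hxpos i) (hxpos (i + 1)) K L,
    fun i K => sum_balancedMatrix (hxx i) K, ⟨hcompat, fun g => ?_, ?_, fun g => ⟨?_, ?_⟩⟩, ?_⟩
  · obtain ⟨i, y, rfl⟩ := h.surj g
    obtain ⟨w, hw, -⟩ := h.exists_lift (Nat.le_succ i) y
    obtain ⟨v, hv, -⟩ := hsurj (i + 1) w (Nat.succ_pos i)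
    exact ⟨i + 1, v, hv.trans hw⟩
  · have key : ∀ i r, Vanishes M i r → ∀ (c : ℕ) v, weightedCollapse (x i) v = c • r →
        Vanishes (d := fun i => d i * 2) B i v := by
      intro i r hr
      induction hr with
      | zero i =>
        intro c v hv
        rw [smul_zero] at hv
        refine Vanishes.step (d := fun i => d i * 2) _ _ ?_
        have : natMulVec (B i) v = 0 := by
          ext K
          have e := weight_mul_balancedMatrix (M := M i) (x := x i) (x' := x (i + 1)) (t := t i)
            v K
          rw [hv, map_zero, Pi.zero_apply, mul_zero] at e
          exact (mul_eq_zero.1 e).resolve_left (by exact_mod_cast (hxpos _ _).ne')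
        exact this ▸ Vanishes.zero (d := fun i => d i * 2) (i + 1)
      | step i r _ ih =>
        intro c v hv
        refine Vanishes.step (d := fun i => d i * 2) _ _ (ih (m i * c) _ ?_)
        rw [weightedCollapse_balancedMatrix, hv, map_nsmul]
        exact (mul_smul (m i) c _).symm
    intro i v hv
    refine key i _ (h.vanishes i (weightedCollapse (x i) v) ?_) 1 v (one_smul _ _).symm
    rw [← hε, hv, smul_zero]
  · intro hg
    obtain ⟨i, y, hy, rfl⟩ := (h.mem_iff g).1 hg
    obtain ⟨w, hw, hw0⟩ := h.exists_lift (Nat.le_succ i) y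
    obtain ⟨v, hv, hv0⟩ := hsurj (i + 1) w (Nat.succ_pos i)
    exact ⟨i + 1, v, hv0 (hw0 hy), hv.trans hw⟩
  · rintro ⟨i, v, hv, rfl⟩
    refine h.unperforated (hHpos i) ?_
    rw [hε]
    refine (h.mem_iff _).2 ⟨i, _, fun k => ?_, rfl⟩
    rw [weightedCollapse_apply]
    exact mul_nonneg (Int.natCast_nonneg _) (Finset.sum_nonneg fun s _ => hv _)
  · refine hcancel _ (hHpos 0) _ _ ?_
    rw [hε, ← hu, ← map_nsmul]
    congr 1
    ext k
    rw [weightedCollapse_apply]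
    simp [hH, hx, weights]
    ring

/-! ### Words made of runs -/

/-- The word `0^{b 0} 1^{b 1} ⋯ (d-1)^{b (d-1)}`. -/
def runLetter (d : ℕ) (b : ℕ → ℕ) (s : ℕ) : ℕ :=
  Nat.findGreatest (fun l => ∑ j ∈ Finset.range l, b j ≤ s) (d - 1)

section runs

variable {d : ℕ} {b : ℕ → ℕ}

lemma runLetter_eq {l s : ℕ} (hl : l < d) (h1 : ∑ j ∈ Finset.range l, b j ≤ s)
    (h2 : s < ∑ j ∈ Finset.range (l + 1), b j) : runLetter d b s = l := by
  rw [runLetter, Nat.findGreatest_eq_iff]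
  refine ⟨by omega, fun _ => h1, fun n hn _ h3 => ?_⟩
  have : ∑ j ∈ Finset.range (l + 1), b j ≤ ∑ j ∈ Finset.range n, b j :=
    Finset.sum_le_sum_of_subset (Finset.range_subset_range.2 hn)
  omega

lemma runLetter_lt (hd : 0 < d) (s : ℕ) : runLetter d b s < d := by
  have := Nat.findGreatest_le (P := fun l => ∑ j ∈ Finset.range l, b j ≤ s) (d - 1)
  rw [← runLetter] at this
  omega

lemma le_of_runLetter (s : ℕ) : ∑ j ∈ Finset.range (runLetter d b s), b j ≤ s :=
  Nat.findGreatest_spec (P := fun l => ∑ j ∈ Finset.range l, b j ≤ s) (m := 0)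
    (Nat.zero_le _) (by simp)

lemma lt_of_runLetter {s : ℕ} (hs : s < ∑ j ∈ Finset.range d, b j) :
    s < ∑ j ∈ Finset.range (runLetter d b s + 1), b j := by
  have hd : 0 < d := Nat.pos_of_ne_zero (by rintro rfl; simp at hs)
  by_contra! hc
  rcases Nat.lt_or_ge (d - 1) (runLetter d b s + 1) with h | h
  · have := runLetter_lt (b := b) hd s
    rw [show runLetter d b s + 1 = d by omega] at hc
    omega
  · have := Nat.le_findGreatest (P := fun l => ∑ j ∈ Finset.range l, b j ≤ s) h hc
    rw [← runLetter] at this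
    omega

lemma sum_runLetter (v : ℕ → ℤ) {L : ℕ} (hL : L ≤ d) :
    ∑ s ∈ Finset.range (∑ j ∈ Finset.range L, b j), v (runLetter d b s) =
      ∑ l ∈ Finset.range L, (b l : ℤ) * v l := by
  induction L with
  | zero => simp
  | succ L ih =>
    rw [Finset.sum_range_succ (fun l => (b l : ℤ) * v l), Finset.sum_range_succ b,
      Finset.sum_range_add, ih (by omega)]
    congr 1
    rw [Finset.sum_congr rfl fun s hs => by
      rw [runLetter_eq (d := d) (b := b) (l := L) hL (Nat.le_add_right _ _) (by
        rw [Finset.sum_range_succ]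
        have := Finset.mem_range.1 hs
        omega)]]
    simp

end runs

/-- Run lengths `r`, with one unit moved from the second run to the first. -/
def movedRuns (r : ℕ → ℕ) (j : ℕ) : ℕ :=
  if j = 0 then r 0 + 1 else if j = 1 then r 1 - 1 else r j

/-- The word `0^{k+1} 1 0^{r 0 - k - 1} 1^{r 1 - 1} 2^{r 2} ⋯ (d-1)^{r (d-1)}`. -/
def taggedLetter (d : ℕ) (r : ℕ → ℕ) (k s : ℕ) : ℕ :=
  if s = k + 1 then 1 else runLetter d (movedRuns r) s

section tagged

variable {d : ℕ} {r : ℕ → ℕ} {k b : ℕ}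

lemma sum_movedRuns_mul (hd : 2 ≤ d) (hr : 1 ≤ r 1) (v : ℕ → ℤ) :
    ∑ l ∈ Finset.range d, (movedRuns r l : ℤ) * v l =
      ∑ l ∈ Finset.range d, (r l : ℤ) * v l + v 0 - v 1 := by
  obtain ⟨e, rfl⟩ := Nat.exists_eq_add_of_le' hd
  rw [Finset.sum_range_succ', Finset.sum_range_succ', Finset.sum_range_succ',
    Finset.sum_range_succ']
  simp [movedRuns, hr]
  ring

lemma sum_movedRuns (hd : 2 ≤ d) (hr : 1 ≤ r 1) :
    ∑ l ∈ Finset.range d, movedRuns r l = ∑ l ∈ Finset.range d, r l := by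
  have := sum_movedRuns_mul hd hr fun _ => 1
  simp only [mul_one, add_sub_cancel_right] at this
  exact_mod_cast this

lemma taggedLetter_lt (hd : 2 ≤ d) (s : ℕ) : taggedLetter d r k s < d := by
  rw [taggedLetter]
  split_ifs
  · omega
  · exact runLetter_lt (by omega) s

lemma taggedLetter_tag : taggedLetter d r k (k + 1) = 1 := by simp [taggedLetter]

lemma runLetter_movedRuns_eq_zero (hd : 2 ≤ d) {s : ℕ} (hs : s ≤ r 0) :
    runLetter d (movedRuns r) s = 0 :=
  runLetter_eq (by omega) (by simp) (by simp [movedRuns]; omega)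

lemma taggedLetter_eq_zero (hd : 2 ≤ d) {s : ℕ} (hs : s ≤ r 0) (hsk : s ≠ k + 1) :
    taggedLetter d r k s = 0 := by
  rw [taggedLetter, if_neg hsk, runLetter_movedRuns_eq_zero hd hs]

lemma le_of_taggedLetter_eq_zero (hr : 1 ≤ r 1) (hd : 2 ≤ d) {s : ℕ}
    (hs : s < ∑ l ∈ Finset.range d, r l) (h : taggedLetter d r k s = 0) :
    s ≤ r 0 ∧ s ≠ k + 1 := by
  rw [taggedLetter] at h
  split_ifs at h with hk
  refine ⟨?_, hk⟩
  rw [← sum_movedRuns hd hr] at hs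
  have := lt_of_runLetter hs
  rw [h] at this
  simp [movedRuns] at this
  omega

lemma sum_taggedLetter (hd : 2 ≤ d) (hr : 1 ≤ r 1) (hk : k + 1 ≤ r 0) (v : ℕ → ℤ) :
    ∑ s ∈ Finset.range (∑ l ∈ Finset.range d, r l), v (taggedLetter d r k s) =
      ∑ l ∈ Finset.range d, (r l : ℤ) * v l := by
  have hmem : k + 1 ∈ Finset.range (∑ l ∈ Finset.range d, r l) := by
    rw [Finset.mem_range]
    obtain ⟨e, rfl⟩ := Nat.exists_eq_add_of_le' hd
    rw [Finset.sum_range_succ', Finset.sum_range_succ']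
    simp only [zero_add]
    omega
  have h1 : ∑ s ∈ Finset.range (∑ l ∈ Finset.range d, r l), v (taggedLetter d r k s) =
      ∑ s ∈ Finset.range (∑ l ∈ Finset.range d, r l), v (runLetter d (movedRuns r) s) +
        v 1 - v 0 := by
    rw [← Finset.add_sum_erase _ _ hmem, ← Finset.add_sum_erase _ _ hmem, taggedLetter_tag,
      runLetter_movedRuns_eq_zero hd hk]
    rw [Finset.sum_congr rfl fun s hs => by
      rw [taggedLetter, if_neg (Finset.mem_erase.1 hs).1]]
    ring
  rw [h1, ← sum_movedRuns hd hr, sum_runLetter v le_rfl, sum_movedRuns_mul hd hr]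
  ring

lemma movedRuns_ge (hr : ∀ l < d, b ≤ r l) {l : ℕ} (hl : l < d) : b - 1 ≤ movedRuns r l := by
  have := hr l hl
  rw [movedRuns]
  split_ifs with h1 h2
  · subst h1; omega
  · subst h2; omega
  · omega

lemma taggedLetter_last (hd : 2 ≤ d) (hr : ∀ l < d, b ≤ r l) (hb : k + 3 ≤ b) {s : ℕ}
    (hs : s < ∑ l ∈ Finset.range d, r l) (hs' : ∑ l ∈ Finset.range d, r l ≤ s + (b - 1)) :
    taggedLetter d r k s = d - 1 := by
  have h1 := hr 1 (by omega)
  have h0 := hr 0 (by omega)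
  rw [← sum_movedRuns hd (by omega)] at hs hs'
  obtain ⟨e, rfl⟩ := Nat.exists_eq_add_of_le' hd
  have hl := movedRuns_ge hr (l := e + 1) (by omega)
  have hne : s ≠ k + 1 := by
    rw [Finset.sum_range_succ, Finset.sum_range_succ'] at hs'
    have : movedRuns r 0 = r 0 + 1 := rfl
    have : movedRuns r (e + 1) ≤ ∑ l ∈ Finset.range (e + 2), movedRuns r l :=
      Finset.single_le_sum (f := movedRuns r) (fun _ _ => Nat.zero_le _) (by simp)
    omega
  rw [taggedLetter, if_neg hne]
  refine runLetter_eq (by omega) ?_ hs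
  rw [Finset.sum_range_succ] at hs'
  simp only [Nat.add_one_sub_one]
  omega

/-- Past the tag, short windows contain at most one change of letter. -/
lemma taggedLetter_window (hd : 2 ≤ d) (hr : ∀ l < d, b ≤ r l) (hb : 2 ≤ b) {s n : ℕ}
    (hs : k + 2 ≤ s) (hsn : s + n ≤ ∑ l ∈ Finset.range d, r l) (hn : n + 1 ≤ b) (hn0 : 0 < n) :
    ∃ j < d, ∃ a ≤ n, ∀ t < n, taggedLetter d r k (s + t) = if t < a then j else j + 1 := by
  have h1 := hr 1 (by omega)
  rw [← sum_movedRuns hd (by omega)] at hsn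
  have hlt := lt_of_runLetter (d := d) (b := movedRuns r) (s := s) (by omega)
  have hle := le_of_runLetter (d := d) (b := movedRuns r) s
  have hjd := runLetter_lt (d := d) (b := movedRuns r) (by omega) s
  set j := runLetter d (movedRuns r) s
  refine ⟨j, hjd, min n (∑ l ∈ Finset.range (j + 1), movedRuns r l - s), min_le_left _ _,
    fun t ht => ?_⟩
  rw [taggedLetter, if_neg (by omega)]
  split_ifs with hta
  · exact runLetter_eq hjd (by omega) (by omega)
  · have hj1 : j + 1 < d := by
      by_contra! hc
      rw [show j + 1 = d by omega] at hta
      omega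
    have := movedRuns_ge hr hj1
    refine runLetter_eq hj1 (by omega) ?_
    rw [Finset.sum_range_succ]
    omega

end tagged

/-! ### Substitutions with prescribed letter counts -/

/-- The set of words of length `n` occurring in a two-sided sequence. -/
def windows {α : Type*} (z : ℤ → α) (n : ℕ) : Set (Fin n → α) :=
  Set.range fun (c : ℤ) (j : Fin n) => z (c + (j : ℕ))

/-- `z` is the image of `y` under the substitution of constant length `m` given by `τ`. -/
def IsSubstituted {α β : Type*} (m : ℕ) (τ : β → ℕ → α) (z : ℤ → α) (y : ℤ → β) : Prop :=
  ∀ (q : ℤ) (s : ℕ), s < m → z (q * m + s) = τ (y q) s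

/-- Constant length words with letter counts `B`, all beginning with the first and ending with
the last letter, from whose concatenations they can be recovered, and such that these
concatenations contain few short words. -/
structure IsGoodSubstitution {d d' : ℕ} (m b : ℕ) (B : Fin d' → Fin d → ℕ)
    (first last : Fin d) (τ : Fin d' → ℕ → Fin d) : Prop where
  sum_eq : ∀ k (v : Fin d → ℤ), ∑ s ∈ Finset.range m, v (τ k s) = natMulVec B v k
  first_eq : ∀ k, τ k 0 = first
  last_eq : ∀ k, τ k (m - 1) = last
  injective : ∀ k k', (∀ s < m, τ k s = τ k' s) → k = k'
  dvd_iff : ∀ z z', IsSubstituted m τ z z' → ∀ n : ℤ,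
    (m : ℤ) ∣ n ↔ z (n - 2) = last ∧ z (n - 1) = last ∧ z n = first
  card_windows : ∀ z z', IsSubstituted m τ z z' → ∀ n, 0 < n → n + d' + 3 ≤ b →
    (windows z n).ncard ≤ (d + d') * (n + d' + 3)

lemma ncard_le_of_subset_range {α β : Type*} [Fintype α] (f : α → β) {S : Set β}
    (h : S ⊆ Set.range f) : S.ncard ≤ Fintype.card α := by
  have hf : (Set.range f).Finite := Set.finite_range f
  refine (Set.ncard_le_ncard h hf).trans ?_
  rw [← Set.image_univ]
  exact (Set.ncard_image_le Set.finite_univ).trans (by simp [Set.ncard_univ])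

lemma exists_eq_mul_add {m : ℕ} (hm : 0 < m) (n : ℤ) :
    ∃ (q : ℤ) (s : ℕ), s < m ∧ n = q * m + s := by
  have h0 : 0 ≤ n % (m : ℤ) := Int.emod_nonneg _ (by omega)
  have h1 : n % (m : ℤ) < m := Int.emod_lt_of_pos _ (by omega)
  refine ⟨n / m, (n % m).toNat, by omega, ?_⟩
  rw [Int.toNat_of_nonneg h0, Int.ediv_mul_add_emod]

theorem exists_goodSubstitution {d d' m b : ℕ} (hd : 2 ≤ d) (B : Fin d' → Fin d → ℕ)
    (hb : d' + 3 ≤ b) (hB : ∀ k l, b ≤ B k l) (hm : ∀ k, ∑ l, B k l = m) :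
    ∃ τ, IsGoodSubstitution m b B ⟨0, by omega⟩ ⟨d - 1, by omega⟩ τ := by
  let r : Fin d' → ℕ → ℕ := fun k l => if h : l < d then B k ⟨l, h⟩ else 0
  have hr : ∀ k, ∀ l < d, b ≤ r k l := fun k l hl => by
    simp only [r, dif_pos hl]; exact hB _ _
  have hr0 : ∀ k, b ≤ r k 0 := fun k => hr k 0 (by omega)
  have hr1 : ∀ k, b ≤ r k 1 := fun k => hr k 1 (by omega)
  have hrm : ∀ k, ∑ l ∈ Finset.range d, r k l = m := fun k => by
    rw [← hm k, Finset.sum_range]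
    exact Finset.sum_congr rfl fun l _ => by simp [r]
  have hmb : ∀ _ : Fin d', 2 * b ≤ m := fun k => by
    rw [← hrm k]
    calc 2 * b ≤ d * b := Nat.mul_le_mul_right b hd
      _ = ∑ l ∈ Finset.range d, b := by simp
      _ ≤ _ := Finset.sum_le_sum fun l hl => hr k l (Finset.mem_range.1 hl)
  let τ : Fin d' → ℕ → Fin d := fun k s => ⟨taggedLetter d (r k) k s, taggedLetter_lt hd s⟩
  have hzero : ∀ (k : Fin d') s, s ≤ b → s ≠ k + 1 → τ k s = ⟨0, by omega⟩ := fun k s hs hk =>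
    Fin.ext (taggedLetter_eq_zero hd (hs.trans (hr0 k)) hk)
  have hone : ∀ k : Fin d', τ k (k + 1) = ⟨1, by omega⟩ := fun k => Fin.ext taggedLetter_tag
  have hlast : ∀ (k : Fin d') s, s < m → m ≤ s + (b - 1) → τ k s = ⟨d - 1, by omega⟩ :=
    fun k s hs hs' => Fin.ext (taggedLetter_last hd (hr k) (by omega) (by rwa [hrm])
      (by rwa [hrm]))
  refine ⟨τ, ?_, fun k => hzero k 0 (by omega) (by omega), fun k => ?_, fun k k' h => ?_, ?_, ?_⟩
  · intro k v
    let v' : ℕ → ℤ := fun l => if h : l < d then v ⟨l, h⟩ else 0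
    have hv' : ∀ s, v (τ k s) = v' (taggedLetter d (r k) k s) := fun s => by
      simp only [v', dif_pos (taggedLetter_lt hd s), τ]
    have := hr0 k
    have := hr1 k
    rw [Finset.sum_congr rfl fun s _ => hv' s, ← hrm k,
      sum_taggedLetter hd (by omega) (by omega), Finset.sum_range, natMulVec_apply]
    exact Finset.sum_congr rfl fun l _ => by simp [r, v']
  · have := hmb k
    exact hlast k _ (by omega) (by omega)
  · have := hmb k
    rcases lt_trichotomy (k : ℕ) k' with hlt | heq | hlt
    · have h1 := h (k + 1) (by omega)
      rw [hone, hzero k' _ (by omega) (by omega)] at h1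
      simp at h1
    · exact Fin.ext heq
    · have h1 := h (k' + 1) (by omega)
      rw [hone, hzero k _ (by omega) (by omega)] at h1
      simp at h1
  · intro z z' hz n
    have hm2 := hmb (z' 0)
    constructor
    · rintro ⟨q, rfl⟩
      refine ⟨?_, ?_, ?_⟩
      · rw [show (m : ℤ) * q - 2 = (q - 1) * m + (m - 2 : ℕ) by
          rw [Nat.cast_sub (by omega)]; push_cast; ring, hz _ _ (by omega)]
        exact hlast _ _ (by omega) (by omega)
      · rw [show (m : ℤ) * q - 1 = (q - 1) * m + (m - 1 : ℕ) by
          rw [Nat.cast_sub (by omega)]; push_cast; ring, hz _ _ (by omega)]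
        exact hlast _ _ (by omega) (by omega)
      · rw [show (m : ℤ) * q = q * m + (0 : ℕ) by push_cast; ring, hz _ _ (by omega)]
        exact hzero _ _ (by omega) (by omega)
    · obtain ⟨q, s, hs, rfl⟩ := exists_eq_mul_add (m := m) (by omega) n
      rintro ⟨h2, h1, h0⟩
      by_contra hdvd
      have hs0 : s ≠ 0 := by
        rintro rfl
        exact hdvd (by simp)
      rw [hz q s hs] at h0
      obtain ⟨hs1, hsk⟩ := le_of_taggedLetter_eq_zero (by have := hr1 (z' q); omega) hd
        (by rwa [hrm]) (Fin.ext_iff.1 h0)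
      rw [show q * m + (s : ℤ) - 1 = q * m + (s - 1 : ℕ) by
        push_cast [Nat.pos_of_ne_zero hs0]; ring,
        hz _ _ (by omega)] at h1
      have hk : s - 1 = z' q + 1 := by
        by_contra hk
        have : taggedLetter d (r (z' q)) (z' q) (s - 1) = 0 :=
          taggedLetter_eq_zero hd (by omega) hk
        have h1' : taggedLetter d (r (z' q)) (z' q) (s - 1) = d - 1 := Fin.ext_iff.1 h1
        omega
      rw [show q * m + (s : ℤ) - 2 = q * m + (s - 2 : ℕ) by
        rw [Nat.cast_sub (by omega)]; push_cast; ring, hz _ _ (by omega),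
        hzero _ _ (by omega) (by omega)] at h2
      have := Fin.ext_iff.1 h2
      simp only at this
      omega
  · intro z z' hz n hn hnb
    have hm2 := hmb (z' 0)
    let seam : Fin d' × Fin (n + d' + 2) → Fin n → Fin d := fun p t =>
      if (t : ℕ) + p.2 < n then ⟨d - 1, by omega⟩ else
        if (t : ℕ) + p.2 - n = p.1 + 1 then ⟨1, by omega⟩ else ⟨0, by omega⟩
    let step : Fin d × Fin (n + 1) → Fin n → Fin d := fun p t =>
      if t < (p.2 : ℕ) then p.1 else if h : p.1 + 1 < d then ⟨p.1 + 1, h⟩ else p.1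
    have hsub : windows z n ⊆ Set.range (Sum.elim seam step) := by
      rintro _ ⟨c, rfl⟩
      obtain ⟨q, s, hs, rfl⟩ := exists_eq_mul_add (m := m) (by omega) c
      have hin : ∀ t : ℕ, s + t < m → z (q * m + s + t) = τ (z' q) (s + t) := fun t ht => by
        rw [add_assoc, ← Nat.cast_add, hz _ _ ht]
      have hout : ∀ t : ℕ, m ≤ s + t → s + t < 2 * m →
          z (q * m + s + t) = τ (z' (q + 1)) (s + t - m) := fun t ht ht' => by
        rw [show q * m + (s : ℤ) + t = (q + 1) * m + (s + t - m : ℕ) by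
          rw [Nat.cast_sub ht]; push_cast; ring, hz _ _ (by omega)]
      have hpre : ∀ (k : Fin d') s, s ≤ b → τ k s =
          if s = k + 1 then ⟨1, by omega⟩ else ⟨0, by omega⟩ := fun k s hs => by
        split_ifs with h
        · rw [h, hone]
        · exact hzero k s hs h
      rcases Nat.lt_or_ge m (s + n) with h1 | h1
      · refine ⟨Sum.inl (z' (q + 1), ⟨n - (m - s), by omega⟩), ?_⟩
        ext1 t
        simp only [Sum.elim_inl, seam]
        split_ifs with h2 h3
        · rw [hin _ (by omega), hlast _ _ (by omega) (by omega)]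
        · rw [hout _ (by omega) (by omega), hpre _ _ (by omega), if_pos (by omega)]
        · rw [hout _ (by omega) (by omega), hpre _ _ (by omega), if_neg (by omega)]
      rcases Nat.lt_or_ge s (z' q + 2) with h2 | h2
      · refine ⟨Sum.inl (z' q, ⟨n + s, by omega⟩), ?_⟩
        ext1 t
        simp only [Sum.elim_inl, seam]
        rw [if_neg (by omega), hin _ (by omega), hpre _ _ (by omega)]
        exact if_congr (by omega) rfl rfl
      · obtain ⟨j, hj, a, ha, hw⟩ := taggedLetter_window (k := z' q) hd (hr (z' q))
          (by omega) h2 (by rwa [hrm]) (by omega) hn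
        refine ⟨Sum.inr (⟨j, hj⟩, ⟨a, by omega⟩), ?_⟩
        ext t
        simp only [Sum.elim_inr, step]
        have ht := hw t t.2
        rw [hin _ (by omega)]
        have hlt := taggedLetter_lt (r := r (z' q)) (k := z' q) hd (s + t)
        simp only [τ]
        rw [ht] at hlt ⊢
        by_cases h3 : (t : ℕ) < a
        · rw [if_pos h3, if_pos h3]
        · rw [if_neg h3] at hlt
          rw [if_neg h3, if_neg h3, dif_pos hlt]
    refine (ncard_le_of_subset_range _ hsub).trans ?_
    simp only [Fintype.card_sum, Fintype.card_prod, Fintype.card_fin]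
    nlinarith

/-! ### Towers of substitutions -/

/-- A sequence of substitutions together with two-sided sequences `x i` such that `x i` is the
image of `x (i + 1)`. -/
structure Tower where
  d : ℕ → ℕ
  m : ℕ → ℕ
  b : ℕ → ℕ
  B : ∀ i, Fin (d (i + 1)) → Fin (d i) → ℕ
  first : ∀ i, Fin (d i)
  last : ∀ i, Fin (d i)
  τ : ∀ i, Fin (d (i + 1)) → ℕ → Fin (d i)
  x : ∀ i, ℤ → Fin (d i)
  two_le : ∀ i, 2 ≤ m i
  B_pos : ∀ i k l, 0 < B i k l
  good : ∀ i, IsGoodSubstitution (m i) (b i) (B i) (first i) (last i) (τ i)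
  subst : ∀ i, IsSubstituted (m i) (τ i) (x i) (x (i + 1))

/-- The sequences obtained by iterating the substitutions `τ i` from the seed `last . first`. -/
def levelSeq {d m : ℕ → ℕ} (hm : ∀ i, 2 ≤ m i) (first last : ∀ i, Fin (d i))
    (τ : ∀ i, Fin (d (i + 1)) → ℕ → Fin (d i)) (i : ℕ) (n : ℤ) : Fin (d i) :=
  if n = 0 then first i else if n = -1 then last i else
    τ i (levelSeq hm first last τ (i + 1) (n / m i)) (n % m i).toNat
termination_by n.natAbs
decreasing_by
  have := hm i
  have h2 := Int.mul_ediv_add_emod n (m i)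
  have h3 := Int.emod_nonneg n (b := m i) (by omega)
  have h4 := Int.emod_lt_of_pos n (b := m i) (by omega)
  rcases lt_trichotomy (n / (m i : ℤ)) (-1) with h | h | h
  · have : n < n / m i := by nlinarith
    omega
  · rw [h] at h2 ⊢
    omega
  · rcases Int.lt_or_le 0 (n / (m i : ℤ)) with h' | h'
    · have : n / m i < n := by nlinarith
      omega
    · rw [show n / (m i : ℤ) = 0 by omega]
      omega

lemma isSubstituted_levelSeq {d m : ℕ → ℕ} (hm : ∀ i, 2 ≤ m i) {first last : ∀ i, Fin (d i)}
    {τ : ∀ i, Fin (d (i + 1)) → ℕ → Fin (d i)} (h0 : ∀ i k, τ i k 0 = first i)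
    (h1 : ∀ i k, τ i k (m i - 1) = last i) (i : ℕ) :
    IsSubstituted (m i) (τ i) (levelSeq hm first last τ i) (levelSeq hm first last τ (i + 1)) := by
  intro q s hs
  have hmi := hm i
  have hq : (q * m i + s) / (m i : ℤ) = q := by
    rw [add_comm, Int.add_mul_ediv_right _ _ (by omega),
      Int.ediv_eq_zero_of_lt (by omega) (by omega), zero_add]
  have hs' : ((q * m i + s) % (m i : ℤ)).toNat = s := by
    rw [add_comm, Int.add_mul_emod_self_right, Int.emod_eq_of_lt (by omega) (by omega),
      Int.toNat_natCast]
  rw [levelSeq]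
  split_ifs with hz hz'
  · rw [hz, Int.zero_emod] at hs'
    rw [← hs', Int.toNat_zero, h0]
  · rw [hz', Int.neg_emod, if_neg (by rw [Int.natCast_dvd]; simpa using by omega),
      Int.emod_eq_of_lt (by omega) (by omega)] at hs'
    rw [show s = m i - 1 by omega, h1]
  · rw [hs', hq]

/-- `F` is a function of a window of bounded size of the sequence `x`. -/
def LocallyDetermined {α β : Type*} (x : ℤ → α) (F : ℤ → β) : Prop :=
  ∃ N : ℕ, ∀ n n' : ℤ, (∀ j : ℤ, |j| ≤ N → x (n + j) = x (n' + j)) → F n = F n'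

lemma sum_range_mul {β : Type*} [AddCommMonoid β] (m h : ℕ) (f : ℕ → β) :
    ∑ r ∈ Finset.range (m * h), f r =
      ∑ s ∈ Finset.range m, ∑ r ∈ Finset.range h, f (s * h + r) := by
  induction m with
  | zero => simp
  | succ m ih => rw [Nat.succ_mul, Finset.sum_range_add, ih, Finset.sum_range_succ]

namespace Tower

variable (T : Tower)

/-- The length of the words of level `i`. -/
def h (i : ℕ) : ℕ := ∏ j ∈ Finset.range i, T.m j

lemma h_zero : T.h 0 = 1 := rfl

lemma h_succ (i : ℕ) : T.h (i + 1) = T.h i * T.m i := Finset.prod_range_succ _ _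

lemma h_pos (i : ℕ) : 0 < T.h i := Finset.prod_pos fun j _ => by have := T.two_le j; omega

lemma h_mono : Monotone T.h := monotone_nat_of_le_succ fun i => by
  rw [h_succ]
  exact Nat.le_mul_of_pos_right _ (by have := T.two_le i; omega)

lemma lt_h (i : ℕ) : i < T.h i := by
  induction i with
  | zero => exact T.h_pos 0
  | succ i ih =>
    rw [h_succ]
    have := T.two_le i
    nlinarith

lemma x_mul (i : ℕ) (q : ℤ) : T.x i (q * T.m i) = T.first i := by
  have := T.subst i q 0 (by have := T.two_le i; omega)
  rwa [Nat.cast_zero, add_zero, (T.good i).first_eq] at this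

lemma x_mul_sub_one (i : ℕ) (q : ℤ) : T.x i (q * T.m i - 1) = T.last i := by
  have hm := T.two_le i
  have := T.subst i (q - 1) (T.m i - 1) (by omega)
  rw [(T.good i).last_eq] at this
  rw [← this]
  congr 1
  rw [Nat.cast_sub (by omega)]
  push_cast
  ring

lemma exists_letter (i : ℕ) (k : Fin (T.d i)) : ∃ n, T.x i n = k := by
  have h1 := (T.good i).sum_eq (T.x (i + 1) 0) (fun l => if l = k then 1 else 0)
  simp only [natMulVec_apply, mul_ite, mul_one, mul_zero, Finset.sum_ite_eq', Finset.mem_univ,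
    if_true] at h1
  have h2 : (0 : ℤ) < T.B i (T.x (i + 1) 0) k := by exact_mod_cast T.B_pos i _ k
  obtain ⟨s, hs, hs'⟩ := Finset.exists_ne_zero_of_sum_ne_zero (h1 ▸ h2.ne')
  refine ⟨(0 : ℤ) * T.m i + s, ?_⟩
  rw [T.subst i 0 s (Finset.mem_range.1 hs)]
  by_contra hc
  exact hs' (if_neg hc)

/-- The letter at level `i` determines the word of length `h i` at level `0`. -/
lemma x_block {i : ℕ} {n n' : ℤ} (e : T.x i n = T.x i n') {s : ℕ} (hs : s < T.h i) :
    T.x 0 (n * T.h i + s) = T.x 0 (n' * T.h i + s) := by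
  induction i generalizing n n' s with
  | zero =>
    obtain rfl : s = 0 := by rw [h_zero] at hs; omega
    simpa [h_zero] using e
  | succ i ih =>
    rw [h_succ] at hs
    have ha : s / T.h i < T.m i := Nat.div_lt_of_lt_mul hs
    have key : ∀ n : ℤ, n * T.h (i + 1) + s =
        (n * T.m i + (s / T.h i : ℕ)) * T.h i + (s % T.h i : ℕ) := fun n => by
      have : (s : ℤ) = (T.h i : ℤ) * (s / T.h i : ℕ) + (s % T.h i : ℕ) := by
        exact_mod_cast (Nat.div_add_mod s (T.h i)).symm
      rw [h_succ]
      push_cast at this ⊢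
      linear_combination this
    rw [key, key]
    refine ih ?_ (Nat.mod_lt _ (T.h_pos i))
    rw [T.subst i n _ ha, T.subst i n' _ ha, e]

/-- The sequence looks the same around all multiples of `h (i + 1)`. -/
lemma x_around (i : ℕ) (n n' : ℤ) {j : ℤ} (hj : -(T.h i : ℤ) ≤ j) (hj' : j < T.h i) :
    T.x 0 (n * T.h (i + 1) + j) = T.x 0 (n' * T.h (i + 1) + j) := by
  rcases Int.lt_or_le j 0 with h0 | h0
  · have key : ∀ n : ℤ, n * T.h (i + 1) + j =
        (n * T.m i - 1) * T.h i + (j + T.h i).toNat := fun n => by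
      rw [h_succ, Int.toNat_of_nonneg (by omega)]
      push_cast
      ring
    rw [key, key]
    exact T.x_block (by rw [x_mul_sub_one, x_mul_sub_one]) (by omega)
  · have key : ∀ n : ℤ, n * T.h (i + 1) + j = (n * T.m i) * T.h i + j.toNat := fun n => by
      rw [h_succ, Int.toNat_of_nonneg h0]
      push_cast
      ring
    rw [key, key]
    exact T.x_block (by rw [x_mul, x_mul]) (by omega)

lemma isToeplitzSeq : IsToeplitzSeq (T.x 0) := by
  intro p
  refine ⟨T.h (p.natAbs + 1), T.h_pos _, fun k => ?_⟩
  have := T.lt_h p.natAbs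
  have h1 := T.x_around p.natAbs 0 k (j := p) (by omega) (by omega)
  rw [zero_mul, zero_add] at h1
  rw [h1, add_comm]

/-! #### Recognizability -/

lemma recognize_step (i : ℕ) {n n' : ℤ}
    (hw : ∀ j : ℤ, |j| ≤ (2 * T.m i + 2 : ℕ) → T.x i (n + j) = T.x i (n' + j)) :
    n % T.m i = n' % T.m i ∧ T.x (i + 1) (n / T.m i) = T.x (i + 1) (n' / T.m i) := by
  have hm := T.two_le i
  have hm0 : (T.m i : ℤ) ≠ 0 := by omega
  obtain ⟨q, s, hs, rfl⟩ := exists_eq_mul_add (m := T.m i) (by omega) n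
  have h1 := ((T.good i).dvd_iff _ _ (T.subst i) (q * T.m i)).1 (Dvd.intro_left q rfl)
  have hw' : ∀ j : ℤ, -(T.m i : ℤ) ≤ j → j ≤ T.m i →
      T.x i (q * T.m i + j) = T.x i (n' - s + j) := fun j hj hj' => by
    have := hw (j - s) (by rw [abs_le]; push_cast; omega)
    rwa [show q * (T.m i : ℤ) + s + (j - s) = q * T.m i + j by ring,
      show n' + (j - s) = n' - s + j by ring] at this
  have h2 : (T.m i : ℤ) ∣ n' - s := by
    refine ((T.good i).dvd_iff _ _ (T.subst i) _).2 ⟨?_, ?_, ?_⟩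
    · rw [sub_eq_add_neg, ← hw' _ (by omega) (by omega), ← sub_eq_add_neg]; exact h1.1
    · rw [sub_eq_add_neg, ← hw' _ (by omega) (by omega), ← sub_eq_add_neg]; exact h1.2.1
    · rw [← add_zero (n' - s), ← hw' _ (by omega) (by omega), add_zero]; exact h1.2.2
  obtain ⟨q', hq'⟩ := h2
  obtain rfl : n' = q' * T.m i + s := by linear_combination hq'
  have hdiv : ∀ q : ℤ, (q * T.m i + s) / (T.m i : ℤ) = q := fun q => by
    rw [add_comm, Int.add_mul_ediv_right _ _ hm0, Int.ediv_eq_zero_of_lt (by omega) (by omega),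
      zero_add]
  refine ⟨by simp [Int.add_emod], ?_⟩
  rw [hdiv, hdiv]
  refine (T.good i).injective _ _ fun r hr => ?_
  rw [← T.subst i _ _ hr, ← T.subst i _ _ hr, hw' _ (by omega) (by omega), add_sub_cancel_right]

lemma locallyDetermined_level (i : ℕ) :
    LocallyDetermined (T.x 0) (fun n => (n % (T.h i : ℤ), T.x i (n / T.h i))) := by
  induction i with
  | zero =>
    refine ⟨0, fun n n' h => ?_⟩
    have := h 0 (by simp)
    simpa [h_zero, Int.emod_one] using this
  | succ i ih =>
    obtain ⟨N, hN⟩ := ih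
    have hh := T.h_pos i
    refine ⟨N + (2 * T.m i + 2) * T.h i, fun n n' hw => ?_⟩
    have hlev : ∀ j : ℤ, |j| ≤ (2 * T.m i + 2 : ℕ) →
        n % (T.h i : ℤ) = n' % (T.h i : ℤ) ∧
          T.x i (n / T.h i + j) = T.x i (n' / T.h i + j) := fun j hj => by
      have h1 := hN (n + j * T.h i) (n' + j * T.h i) fun l hl => by
        rw [add_assoc, add_assoc]
        refine hw _ ((abs_add_le _ _).trans ?_)
        rw [abs_mul, Nat.abs_cast, add_comm]
        push_cast at hj ⊢
        gcongr
      simpa [Int.add_mul_ediv_right _ _ (show (T.h i : ℤ) ≠ 0 by omega)] using h1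
    obtain ⟨h1, h2⟩ := T.recognize_step i fun j hj => (hlev j hj).2
    have h3 := (hlev 0 (by rw [abs_zero]; positivity)).1
    have hdiv : ∀ n : ℤ, n / (T.h (i + 1) : ℤ) = n / T.h i / T.m i := fun n => by
      rw [h_succ, Nat.cast_mul, Int.ediv_ediv_of_nonneg (by omega)]
    have hmod : ∀ n : ℤ, n % (T.h (i + 1) : ℤ) =
        n % T.h i + T.h i * (n / T.h i % T.m i) := fun n => by
      have e1 := Int.mul_ediv_add_emod n (T.h (i + 1))
      have e2 := Int.mul_ediv_add_emod n (T.h i)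
      have e3 := Int.mul_ediv_add_emod (n / T.h i) (T.m i)
      rw [hdiv] at e1
      have e4 : (T.h (i + 1) : ℤ) = T.h i * T.m i := by rw [h_succ]; push_cast; rfl
      rw [e4] at e1 ⊢
      linear_combination e1 - e2 - (T.h i : ℤ) * e3
    simp only [hdiv, hmod, h1, h2, h3]

/-- `F n` depends only on the position of `n` inside its word of level `i` and on the letter
of that word. -/
def LevelDetermined {β : Type*} (i : ℕ) (F : ℤ → β) : Prop :=
  ∀ n n' : ℤ, n % (T.h i : ℤ) = n' % (T.h i : ℤ) → T.x i (n / T.h i) = T.x i (n' / T.h i) →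
    F n = F n'

variable {T}

lemma LevelDetermined.locallyDetermined {β : Type*} {i : ℕ} {F : ℤ → β}
    (hF : T.LevelDetermined i F) : LocallyDetermined (T.x 0) F := by
  obtain ⟨N, hN⟩ := T.locallyDetermined_level i
  refine ⟨N, fun n n' hw => ?_⟩
  have := hN n n' hw
  exact hF n n' (congrArg Prod.fst this) (congrArg Prod.snd this)

lemma exists_levelDetermined {β : Type*} {F : ℤ → β} (hF : LocallyDetermined (T.x 0) F) :
    ∃ i, ∀ j ≥ i, T.LevelDetermined j F ∧ ∀ n n' : ℤ, F (n * T.h j) = F (n' * T.h j) := by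
  obtain ⟨N, hN⟩ := hF
  refine ⟨N + 1, fun j hj => ?_⟩
  obtain ⟨i, rfl⟩ : ∃ i, j = i + 1 := ⟨j - 1, by omega⟩
  have hNi : N < T.h i := (T.lt_h N).trans_le (T.h_mono (by omega))
  refine ⟨fun n n' h1 h2 => hN _ _ fun t ht => ?_, fun n n' => hN _ _ fun t ht => ?_⟩
  · rw [abs_le] at ht
    have hpos := T.h_pos (i + 1)
    have hr0 := Int.emod_nonneg n (b := T.h (i + 1)) (by omega)
    have hr1 := Int.emod_lt_of_pos n (b := T.h (i + 1)) (by omega)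
    have e := Int.ediv_mul_add_emod n (T.h (i + 1))
    have e' := Int.ediv_mul_add_emod n' (T.h (i + 1))
    rw [← h1] at e'
    set r := n % (T.h (i + 1) : ℤ)
    set q := n / (T.h (i + 1) : ℤ)
    set q' := n' / (T.h (i + 1) : ℤ)
    rw [← e, ← e']
    rcases Int.lt_or_le (r + t) 0 with h3 | h3
    · rw [add_assoc, add_assoc]
      exact T.x_around i q q' (by omega) (by omega)
    rcases Int.lt_or_le (r + t) (T.h (i + 1)) with h4 | h4
    · rw [add_assoc, add_assoc, ← Int.toNat_of_nonneg h3]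
      exact T.x_block h2 (by omega)
    · have := T.x_around i (q + 1) (q' + 1) (j := r + t - T.h (i + 1)) (by omega) (by omega)
      convert this using 2 <;> ring
  · rw [abs_le] at ht
    exact T.x_around i n n' (by omega) (by omega)

/-! #### Sums over words -/

/-- The sums of `F` over the words of level `i` are given by the vector `v`. -/
def HasSums (T : Tower) (F : ℤ → ℤ) (i : ℕ) (v : Fin (T.d i) → ℤ) : Prop :=
  ∀ n : ℤ, ∑ r ∈ Finset.range (T.h i), F (n * T.h i + r) = v (T.x i n)

lemma HasSums.succ {F : ℤ → ℤ} {i : ℕ} {v : Fin (T.d i) → ℤ} (hF : T.HasSums F i v) :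
    T.HasSums F (i + 1) (natMulVec (T.B i) v) := by
  intro n
  rw [← (T.good i).sum_eq, h_succ, mul_comm, sum_range_mul]
  refine Finset.sum_congr rfl fun s hs => ?_
  rw [← T.subst i n s (Finset.mem_range.1 hs), ← hF]
  refine Finset.sum_congr rfl fun r _ => ?_
  push_cast
  ring_nf

lemma HasSums.unique {F : ℤ → ℤ} {i : ℕ} {v w : Fin (T.d i) → ℤ} (hv : T.HasSums F i v)
    (hw : T.HasSums F i w) : v = w := by
  ext k
  obtain ⟨n, rfl⟩ := T.exists_letter i k
  rw [← hv, ← hw]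

lemma HasSums.nonneg {F : ℤ → ℤ} {i : ℕ} {v : Fin (T.d i) → ℤ} (hv : T.HasSums F i v)
    (hF : ∀ n, 0 ≤ F n) : 0 ≤ v := fun k => by
  obtain ⟨n, rfl⟩ := T.exists_letter i k
  rw [← hv]
  exact Finset.sum_nonneg fun r _ => hF _

lemma HasSums.add {F F' : ℤ → ℤ} {i : ℕ} {v v' : Fin (T.d i) → ℤ} (hv : T.HasSums F i v)
    (hv' : T.HasSums F' i v') : T.HasSums (fun n => F n + F' n) i (v + v') := fun n => by
  rw [Finset.sum_add_distrib, hv, hv', Pi.add_apply]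

lemma LevelDetermined.exists_hasSums {F : ℤ → ℤ} {i : ℕ} (hF : T.LevelDetermined i F) :
    ∃ v, T.HasSums F i v := by
  choose c hc using T.exists_letter i
  refine ⟨fun k => ∑ r ∈ Finset.range (T.h i), F (c k * T.h i + r), fun n => ?_⟩
  refine Finset.sum_congr rfl fun r hr => ?_
  have hr' := Finset.mem_range.1 hr
  have hdiv : ∀ q : ℤ, (q * T.h i + r) / (T.h i : ℤ) = q := fun q => by
    rw [add_comm, Int.add_mul_ediv_right _ _ (by omega),
      Int.ediv_eq_zero_of_lt (by omega) (by omega), zero_add]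
  exact hF _ _ (by simp [Int.add_emod]) (by rw [hdiv, hdiv, hc])

end Tower

open SymbolicDynamics.FullShift

/-! ### Orbit closures -/

section OrbitClosure

variable {a : ℕ}

lemma exists_window_subset {y : ℤ → Fin a} {U : Set (ℤ → Fin a)} (hU : IsOpen U) (hy : y ∈ U) :
    ∃ N : ℕ, ∀ y' : ℤ → Fin a, (∀ j : ℤ, |j| ≤ N → y' j = y j) → y' ∈ U := by
  obtain ⟨I, u, hu, hI⟩ := isOpen_pi_iff.1 hU y hy
  refine ⟨I.sup Int.natAbs, fun y' h => hI fun j hj => ?_⟩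
  rw [h j]
  · exact (hu j hj).2
  · rw [Int.abs_eq_natAbs]
    exact_mod_cast Finset.le_sup (f := Int.natAbs) hj

lemma isOpen_window (y : ℤ → Fin a) (N : ℕ) :
    IsOpen {y' : ℤ → Fin a | ∀ j : ℤ, |j| ≤ N → y' j = y j} := by
  convert isOpen_cylinder (Finset.Icc (-(N : ℤ)) N) y using 1
  ext y'
  simp [mem_cylinder, abs_le]

/-- The closure of the shift orbit of a sequence. -/
def orbitClosure (x : ℤ → Fin a) : Subshift (Fin a) ℤ where
  carrier := closure (Set.range fun k : ℤ => shift k x)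
  isClosed := isClosed_closure
  mapsTo g := by
    refine Set.MapsTo.closure ?_ (continuous_shift g)
    rintro _ ⟨k, rfl⟩
    exact ⟨k + g, shift_add k g x⟩

variable {x : ℤ → Fin a}

lemma exists_window_eq {y : ℤ → Fin a} (hy : y ∈ (orbitClosure x).carrier) (N : ℕ) :
    ∃ n : ℤ, ∀ j : ℤ, |j| ≤ N → y j = x (n + j) := by
  obtain ⟨_, h, n, rfl⟩ := mem_closure_iff.1 hy _ (isOpen_window y N) fun _ _ => rfl
  exact ⟨n, fun j hj => (h j hj).symm⟩

variable (x) in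
/-- The points of the orbit. -/
def orbitPoint (n : ℤ) : (orbitClosure x).carrier := ⟨shift n x, subset_closure ⟨n, rfl⟩⟩

lemma orbitPoint_apply (n j : ℤ) : (orbitPoint x n).1 j = x (n + j) := rfl

lemma shiftHomeo_apply (Y : Subshift (Fin a) ℤ) (y : Y.carrier) (j : ℤ) :
    (shiftHomeo Y y).1 j = y.1 (1 + j) := rfl

lemma shiftHomeo_orbitPoint (n : ℤ) :
    shiftHomeo (orbitClosure x) (orbitPoint x n) = orbitPoint x (n + 1) := by
  ext j
  rw [shiftHomeo_apply, orbitPoint_apply, orbitPoint_apply, add_assoc]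

lemma exists_window_subset_orbitClosure {y : (orbitClosure x).carrier}
    {U : Set (orbitClosure x).carrier}
    (hU : IsOpen U) (hy : y ∈ U) :
    ∃ N : ℕ, ∀ y' : (orbitClosure x).carrier, (∀ j : ℤ, |j| ≤ N → y'.1 j = y.1 j) → y' ∈ U := by
  obtain ⟨V, hV, rfl⟩ := isOpen_induced_iff.1 hU
  obtain ⟨N, hN⟩ := exists_window_subset hV hy
  exact ⟨N, fun y' h => hN y'.1 h⟩

lemma exists_orbitPoint_mem {U : Set (orbitClosure x).carrier} (hU : IsOpen U)
    (hne : U.Nonempty) : ∃ n, orbitPoint x n ∈ U := by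
  obtain ⟨y, hy⟩ := hne
  obtain ⟨N, hN⟩ := exists_window_subset_orbitClosure hU hy
  obtain ⟨n, hn⟩ := exists_window_eq y.2 N
  exact ⟨n, hN _ fun j hj => (hn j hj).symm⟩

lemma exists_orbitPoint_eq (f : C((orbitClosure x).carrier, ℤ)) (y : (orbitClosure x).carrier) :
    ∃ n, f (orbitPoint x n) = f y :=
  exists_orbitPoint_mem ((isOpen_discrete {f y}).preimage f.continuous) ⟨y, rfl⟩

lemma eq_of_orbitPoint {f g : C((orbitClosure x).carrier, ℤ)}
    (h : ∀ n, f (orbitPoint x n) = g (orbitPoint x n)) : f = g := by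
  ext y
  obtain ⟨n, hn⟩ := exists_orbitPoint_eq (f - g) y
  simp only [ContinuousMap.sub_apply, h, sub_self] at hn
  omega

lemma locallyDetermined_of_continuous (f : C((orbitClosure x).carrier, ℤ)) :
    LocallyDetermined x fun n => f (orbitPoint x n) := by
  let U : ℕ → Set (orbitClosure x).carrier := fun N =>
    {y | ∀ y' : (orbitClosure x).carrier, (∀ j : ℤ, |j| ≤ N → y'.1 j = y.1 j) → f y' = f y}
  have hUo : ∀ N, IsOpen (U N) := fun N => by
    rw [isOpen_iff_forall_mem_open]
    intro y hy
    refine ⟨_, ?_, (isOpen_window y.1 N).preimage continuous_subtype_val, fun _ _ => rfl⟩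
    intro z hz z' hz'
    rw [hy z hz, hy z' fun j hj => (hz' j hj).trans (hz j hj)]
  have hUc : (Set.univ : Set (orbitClosure x).carrier) ⊆ ⋃ N, U N := fun y _ => by
    obtain ⟨N, hN⟩ := exists_window_subset_orbitClosure (y := y)
      ((isOpen_discrete {f y}).preimage f.continuous) rfl
    exact Set.mem_iUnion.2 ⟨N, fun y' h => hN y' h⟩
  have : CompactSpace (orbitClosure x).carrier :=
    isCompact_iff_compactSpace.1 (orbitClosure x).isClosed.isCompact
  have hmono : Monotone U := fun N N' h y hy y' hy' =>
    hy y' fun j hj => hy' j (hj.trans (by exact_mod_cast h))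
  obtain ⟨N, hN⟩ := isCompact_univ.elim_directed_cover U hUo hUc hmono.directed_le
  exact ⟨N, fun n n' h => hN (Set.mem_univ (orbitPoint x n')) (orbitPoint x n) h⟩

lemma exists_continuous_of_locallyDetermined {F : ℤ → ℤ} (hF : LocallyDetermined x F) :
    ∃ f : C((orbitClosure x).carrier, ℤ), ∀ n, f (orbitPoint x n) = F n := by
  obtain ⟨N, hN⟩ := hF
  choose c hc using fun y : (orbitClosure x).carrier => exists_window_eq y.2 N
  have hlc : IsLocallyConstant fun y => F (c y) := by
    refine (IsLocallyConstant.iff_exists_open _).2 fun y =>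
      ⟨_, (isOpen_window y.1 N).preimage continuous_subtype_val, fun _ _ => rfl, fun y' hy' => ?_⟩
    exact hN _ _ fun j hj => by rw [← hc y' j hj, ← hc y j hj]; exact hy' j hj
  exact ⟨⟨_, hlc.continuous⟩, fun n => hN _ _ fun j hj => (hc (orbitPoint x n) j hj).symm⟩

lemma isMinimalSystem_orbitClosure
    (h : ∀ N : ℕ, ∃ R : ℕ, ∀ n : ℤ, ∃ j ≤ R, ∀ t : ℤ, |t| ≤ N → x (n + j + t) = x t) :
    IsMinimalSystem (shiftHomeo (orbitClosure x)) := by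
  refine ⟨⟨orbitPoint x 0⟩, fun C hC hinv => or_iff_not_imp_left.2 fun hne => ?_⟩
  obtain ⟨y, hy⟩ := Set.nonempty_iff_ne_empty.2 hne
  have hfwd : ∀ z ∈ C, shiftHomeo (orbitClosure x) z ∈ C := fun z hz => by
    rw [← hinv]; exact ⟨z, hz, rfl⟩
  have hbwd : ∀ z, shiftHomeo (orbitClosure x) z ∈ C → z ∈ C := fun z hz => by
    rw [← hinv] at hz
    obtain ⟨w, hw, e⟩ := hz
    rwa [← (shiftHomeo (orbitClosure x)).injective e]
  have hiter : ∀ j : ℕ, ∃ z ∈ C, ∀ t : ℤ, z.1 t = y.1 (j + t) := fun j => by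
    induction j with
    | zero => exact ⟨y, hy, fun t => by simp⟩
    | succ j ih =>
      obtain ⟨z, hz, hzy⟩ := ih
      refine ⟨_, hfwd z hz, fun t => ?_⟩
      rw [shiftHomeo_apply, hzy, show (j : ℤ) + (1 + t) = (j + 1 : ℕ) + t by push_cast; ring]
  have h0 : orbitPoint x 0 ∈ C := by
    by_contra hc
    obtain ⟨N, hN⟩ := exists_window_subset_orbitClosure hC.isOpen_compl hc
    obtain ⟨R, hR⟩ := h N
    obtain ⟨n, hn⟩ := exists_window_eq y.2 (R + N)
    obtain ⟨j, hj, hjt⟩ := hR n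
    obtain ⟨z, hz, hzy⟩ := hiter j
    refine hN z (fun t ht => ?_) hz
    rw [hzy, hn, ← add_assoc, hjt t ht, orbitPoint_apply, zero_add]
    rw [abs_le] at ht ⊢
    push_cast
    omega
  have hall : ∀ n : ℤ, orbitPoint x n ∈ C := fun n => by
    induction n using Int.induction_on with
    | zero => exact h0
    | succ i hi => rw [← shiftHomeo_orbitPoint]; exact hfwd _ hi
    | pred i hi => exact hbwd _ (by rwa [shiftHomeo_orbitPoint, sub_add_cancel])
  by_contra hc
  obtain ⟨n, hn⟩ := exists_orbitPoint_mem hC.isOpen_compl (Set.nonempty_compl.2 hc)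
  exact hn (hall n)

lemma languageOfLength_orbitClosure (n : ℕ) :
    languageOfLength (orbitClosure x) n = windows x n := by
  ext w
  constructor
  · rintro ⟨y, hy, i, hw⟩
    obtain ⟨c, hc⟩ := exists_window_eq hy (i.natAbs + n)
    refine ⟨c + i, ?_⟩
    ext1 j
    rw [hw, hc _ (by rw [abs_le]; omega), ← add_assoc]
  · rintro ⟨c, rfl⟩
    exact ⟨x, (orbitPoint x 0).2 |> fun h => by simpa [orbitPoint] using h, c, fun j => rfl⟩

end OrbitClosure

/-! ### The dimension group of a tower -/

namespace Tower

variable (T : Tower)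

lemma isMinimalSystem : IsMinimalSystem (shiftHomeo (orbitClosure (T.x 0))) := by
  refine isMinimalSystem_orbitClosure fun N => ⟨T.h (N + 1), fun n => ?_⟩
  have hN := T.lt_h N
  have hpos := T.h_pos (N + 1)
  have h0 := Int.emod_nonneg (-n) (b := T.h (N + 1)) (by omega)
  have h1 := Int.emod_lt_of_pos (-n) (b := T.h (N + 1)) (by omega)
  have e := Int.ediv_mul_add_emod (-n) (T.h (N + 1))
  refine ⟨((-n) % (T.h (N + 1) : ℤ)).toNat, by omega, fun t ht => ?_⟩
  rw [abs_le] at ht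
  rw [Int.toNat_of_nonneg h0, show n + -n % (T.h (N + 1) : ℤ) + t =
    (-(-n / (T.h (N + 1) : ℤ))) * T.h (N + 1) + t by linear_combination e]
  have := T.x_around N (-(-n / (T.h (N + 1) : ℤ))) 0 (j := t) (by omega) (by omega)
  rwa [zero_mul, zero_add] at this

lemma isToeplitzSubshift : IsToeplitzSubshift (orbitClosure (T.x 0)) :=
  ⟨T.x 0, T.isToeplitzSeq, rfl⟩

variable {T}

/-- The sums over words of level `i` of the values of `f` along the orbit are given by `v`. -/
def OrbitSums (f : C((orbitClosure (T.x 0)).carrier, ℤ)) (i : ℕ) (v : Fin (T.d i) → ℤ) : Prop :=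
  T.HasSums (fun n => f (orbitPoint (T.x 0) n)) i v

lemma exists_orbitSums (f : C((orbitClosure (T.x 0)).carrier, ℤ)) : ∃ i v, OrbitSums f i v := by
  obtain ⟨i, hi⟩ := exists_levelDetermined (locallyDetermined_of_continuous f)
  exact ⟨i, (hi i le_rfl).1.exists_hasSums⟩

section

variable {G : Type*} [AddCommGroup G] {P : Set G} {γ : ∀ i, (Fin (T.d i) → ℤ) →+ G}

lemma HasSums.lift (hγ : IsPresentation P T.B γ) {F : ℤ → ℤ} {i : ℕ} {v : Fin (T.d i) → ℤ}
    (h : T.HasSums F i v) {j : ℕ} (hij : i ≤ j) : ∃ w, T.HasSums F j w ∧ γ j w = γ i v := by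
  induction j, hij using Nat.le_induction with
  | base => exact ⟨v, h, rfl⟩
  | succ j _ ih =>
    obtain ⟨w, hw, e⟩ := ih
    exact ⟨_, hw.succ, (hγ.compat j w).trans e⟩

lemma HasSums.value_unique (hγ : IsPresentation P T.B γ) {F : ℤ → ℤ} {i j : ℕ}
    {v : Fin (T.d i) → ℤ} {w : Fin (T.d j) → ℤ} (hv : T.HasSums F i v) (hw : T.HasSums F j w) :
    γ i v = γ j w := by
  obtain ⟨v', hv', ev⟩ := hv.lift hγ (le_max_left i j)
  obtain ⟨w', hw', ew⟩ := hw.lift hγ (le_max_right i j)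
  rw [← ev, ← ew, hv'.unique hw']

lemma HasSums.exists_zero {F : ℤ → ℤ} {i : ℕ} {v : Fin (T.d i) → ℤ} (hv : T.HasSums F i v)
    (h0 : Vanishes T.B i v) : ∃ j, T.HasSums F j 0 := by
  induction h0 with
  | zero i => exact ⟨i, hv⟩
  | step i v _ ih => exact ih hv.succ

lemma HasSums.zero_of_le {F : ℤ → ℤ} {i j : ℕ} (hij : i ≤ j) (hF : T.HasSums F i 0) :
    T.HasSums F j 0 := by
  induction j, hij using Nat.le_induction with
  | base => exact hF
  | succ j _ ih =>
    have := ih.succ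
    rwa [map_zero] at this

/-- The homomorphism from `C(Y, ℤ)` to `G` given by sums over words. -/
noncomputable def sumHom (hγ : IsPresentation P T.B γ) :
    C((orbitClosure (T.x 0)).carrier, ℤ) →+ G :=
  AddMonoidHom.mk' (fun f => γ (exists_orbitSums f).choose (exists_orbitSums f).choose_spec.choose)
    fun f g => by
      obtain ⟨v, hv, ev⟩ := HasSums.lift hγ (exists_orbitSums f).choose_spec.choose_spec
        (le_max_left _ (exists_orbitSums g).choose)
      obtain ⟨w, hw, ew⟩ := HasSums.lift hγ (exists_orbitSums g).choose_spec.choose_spec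
        (le_max_right (exists_orbitSums f).choose _)
      rw [← ev, ← ew, ← map_add]
      exact HasSums.value_unique hγ (exists_orbitSums (f + g)).choose_spec.choose_spec (hv.add hw)

lemma sumHom_eq (hγ : IsPresentation P T.B γ) {f : C((orbitClosure (T.x 0)).carrier, ℤ)} {i : ℕ}
    {v : Fin (T.d i) → ℤ} (hv : OrbitSums f i v) : sumHom hγ f = γ i v :=
  HasSums.value_unique hγ (exists_orbitSums f).choose_spec.choose_spec hv

lemma coboundary_orbitPoint (f : C((orbitClosure (T.x 0)).carrier, ℤ)) (n : ℤ) :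
    coboundary (shiftHomeo (orbitClosure (T.x 0))) f (orbitPoint (T.x 0) n) =
      f (orbitPoint (T.x 0) (n + 1)) - f (orbitPoint (T.x 0) n) := by
  rw [← shiftHomeo_orbitPoint]
  rfl

lemma sumHom_coboundary (hγ : IsPresentation P T.B γ)
    (f : C((orbitClosure (T.x 0)).carrier, ℤ)) :
    sumHom hγ (coboundary (shiftHomeo (orbitClosure (T.x 0))) f) = 0 := by
  obtain ⟨i, hi⟩ := exists_levelDetermined (locallyDetermined_of_continuous f)
  rw [sumHom_eq hγ (i := i) (v := 0), map_zero]
  intro n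
  simp only [coboundary_orbitPoint]
  have := Finset.sum_range_sub (fun r : ℕ => f (orbitPoint (T.x 0) (n * T.h i + r))) (T.h i)
  push_cast at this
  simp only [add_assoc] at this ⊢
  rw [this, Pi.zero_apply, sub_eq_zero]
  have e := (hi i le_rfl).2 (n + 1) n
  rw [add_zero, ← e]
  congr 2
  ring

lemma ker_sumHom (hγ : IsPresentation P T.B γ) :
    (sumHom hγ).ker = (coboundary (shiftHomeo (orbitClosure (T.x 0)))).range := by
  apply le_antisymm
  · intro f hf
    obtain ⟨i₀, v₀, h₀⟩ := exists_orbitSums f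
    obtain ⟨i₁, h₁⟩ := h₀.exists_zero (hγ.vanishes _ _ ((sumHom_eq hγ h₀).symm.trans hf))
    obtain ⟨i₂, h₂⟩ := exists_levelDetermined (locallyDetermined_of_continuous f)
    obtain ⟨i, hi1, hi2⟩ : ∃ i, i₁ ≤ i ∧ i₂ ≤ i := ⟨max i₁ i₂, le_max_left _ _, le_max_right _ _⟩
    have hzero := h₁.zero_of_le hi1
    have hlev := (h₂ i hi2).1
    have hpos := T.h_pos i
    set F : ℤ → ℤ := fun n => f (orbitPoint (T.x 0) n) with hF
    have hdiv : ∀ (q : ℤ) (r : ℕ), r < T.h i → (q * T.h i + r) / (T.h i : ℤ) = q :=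
      fun q r hr => by
        rw [add_comm, Int.add_mul_ediv_right _ _ (by omega),
          Int.ediv_eq_zero_of_lt (by omega) (by omega), zero_add]
    have hmod : ∀ (q : ℤ) (r : ℕ), r < T.h i → (q * T.h i + r) % (T.h i : ℤ) = r :=
      fun q r hr => by
        rw [add_comm, Int.add_mul_emod_self_right, Int.emod_eq_of_lt (by omega) (by omega)]
    let E : ℤ → ℤ := fun n => ∑ r ∈ Finset.range (n % T.h i).toNat, F (n / T.h i * T.h i + r)
    have hE : T.LevelDetermined i E := fun n n' h1 h2 => by
      simp only [E, h1]
      refine Finset.sum_congr rfl fun r hr => ?_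
      have := Int.emod_lt_of_pos n' (b := T.h i) (by omega)
      have hr' : r < T.h i := by have := Finset.mem_range.1 hr; omega
      exact hlev _ _ (by rw [hmod _ _ hr', hmod _ _ hr']) (by rw [hdiv _ _ hr', hdiv _ _ hr', h2])
    have hEval : ∀ (q : ℤ) (s : ℕ), s ≤ T.h i →
        E (q * T.h i + s) = ∑ r ∈ Finset.range s, F (q * T.h i + r) := fun q s hs => by
      rcases hs.lt_or_eq with hs | rfl
      · simp only [E, hdiv q s hs, hmod q s hs, Int.toNat_natCast]
      · rw [hzero q, show q * (T.h i : ℤ) + T.h i = (q + 1) * T.h i + (0 : ℕ) by push_cast; ring]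
        simp only [E, hmod _ 0 hpos]
        simp
    obtain ⟨g, hg⟩ := exists_continuous_of_locallyDetermined hE.locallyDetermined
    refine ⟨g, eq_of_orbitPoint fun n => ?_⟩
    obtain ⟨q, s, hs, rfl⟩ := exists_eq_mul_add hpos n
    rw [coboundary_orbitPoint, hg, hg, hEval q s hs.le,
      show q * (T.h i : ℤ) + s + 1 = q * T.h i + (s + 1 : ℕ) by push_cast; ring,
      hEval q (s + 1) hs, Finset.sum_range_succ, add_sub_cancel_left]
  · rintro _ ⟨f, rfl⟩
    exact sumHom_coboundary hγ f

lemma exists_sumHom_eq (hγ : IsPresentation P T.B γ) (i : ℕ) (v : Fin (T.d i) → ℤ) :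
    ∃ f : C((orbitClosure (T.x 0)).carrier, ℤ), sumHom hγ f = γ i v ∧ (0 ≤ v → ∀ y, 0 ≤ f y) := by
  have hpos := T.h_pos i
  let F : ℤ → ℤ := fun n => if n % (T.h i : ℤ) = 0 then v (T.x i (n / T.h i)) else 0
  have hF : T.LevelDetermined i F := fun n n' h1 h2 => by simp only [F, h1, h2]
  obtain ⟨f, hf⟩ := exists_continuous_of_locallyDetermined hF.locallyDetermined
  refine ⟨f, sumHom_eq hγ fun n => ?_, fun hv y => ?_⟩
  · rw [Finset.sum_eq_single_of_mem 0 (Finset.mem_range.2 hpos)]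
    · simp [hf, F, Int.mul_ediv_cancel n (show (T.h i : ℤ) ≠ 0 by omega)]
    · intro r hr hr0
      have hr' := Finset.mem_range.1 hr
      simp only [hf, F]
      rw [if_neg]
      rw [add_comm, Int.add_mul_emod_self_right, Int.emod_eq_of_lt (by omega) (by omega)]
      exact_mod_cast hr0
  · obtain ⟨n, hn⟩ := exists_orbitPoint_eq f y
    rw [← hn, hf]
    simp only [F]
    split_ifs
    · exact hv _
    · exact le_rfl

theorem orderedGroupIso (hγ : IsPresentation P T.B γ) :
    OrderedGroupIso (dynHPos (shiftHomeo (orbitClosure (T.x 0))))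
      (dynHUnit (shiftHomeo (orbitClosure (T.x 0)))) P (γ 0 fun _ => 1) := by
  have hsurj : Function.Surjective (sumHom hγ) := fun g => by
    obtain ⟨i, v, rfl⟩ := hγ.surj g
    obtain ⟨f, hf, -⟩ := exists_sumHom_eq hγ i v
    exact ⟨f, hf⟩
  let φ : DynH (shiftHomeo (orbitClosure (T.x 0))) ≃+ G :=
    (QuotientAddGroup.quotientAddEquivOfEq (ker_sumHom hγ).symm).trans
      (QuotientAddGroup.quotientKerEquivOfSurjective _ hsurj)
  have hφ : ∀ f, φ (QuotientAddGroup.mk f) = sumHom hγ f := fun f => rfl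
  refine ⟨φ, ?_, ?_⟩
  · ext g
    rw [hγ.mem_iff]
    constructor
    · rintro ⟨_, ⟨f, hf, rfl⟩, rfl⟩
      obtain ⟨i, v, hv⟩ := exists_orbitSums f
      exact ⟨i, v, hv.nonneg fun n => hf _, ((hφ f).trans (sumHom_eq hγ hv)).symm⟩
    · rintro ⟨i, v, hv, rfl⟩
      obtain ⟨f, hf, hf0⟩ := exists_sumHom_eq hγ i v
      exact ⟨_, ⟨f, hf0 hv, rfl⟩, (hφ f).trans hf⟩
  · refine (hφ _).trans (sumHom_eq hγ fun n => ?_)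
    simp [h_zero]

end

end Tower

/-! ### Complexity -/

namespace Tower

variable (T : Tower)

lemma ncard_windows_le_mul (i : ℕ) {n l : ℕ} (hl : n + T.h i ≤ l * T.h i) :
    (windows (T.x 0) n).ncard ≤ T.h i * (windows (T.x i) l).ncard := by
  have hpos := T.h_pos i
  choose c hc using T.exists_letter i
  have hlt : ∀ (s : Fin (T.h i)) (t : Fin n), ((s : ℕ) + t) / T.h i < l := fun s t =>
    Nat.div_lt_of_lt_mul (by rw [mul_comm]; omega)
  let f : Fin (T.h i) × (Fin l → Fin (T.d i)) → Fin n → Fin (T.d 0) := fun p t =>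
    T.x 0 (c (p.2 ⟨((p.1 : ℕ) + t) / T.h i, hlt p.1 t⟩) * T.h i +
      (((p.1 : ℕ) + t) % T.h i : ℕ))
  have hsub : windows (T.x 0) n ⊆ f '' (Set.univ ×ˢ windows (T.x i) l) := by
    rintro _ ⟨p, rfl⟩
    obtain ⟨q, s, hs, rfl⟩ := exists_eq_mul_add hpos p
    refine ⟨(⟨s, hs⟩, fun j : Fin l => T.x i (q + (j : ℕ))), ⟨Set.mem_univ _, q, rfl⟩, ?_⟩
    ext1 t
    have e : ((s + t : ℕ) : ℤ) = T.h i * ((s + t) / T.h i : ℕ) + ((s + t) % T.h i : ℕ) := by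
      exact_mod_cast (Nat.div_add_mod (s + t) (T.h i)).symm
    simp only [f]
    rw [T.x_block (hc _) (Nat.mod_lt _ hpos)]
    congr 1
    push_cast at e ⊢
    linear_combination -e
  calc (windows (T.x 0) n).ncard ≤ (f '' (Set.univ ×ˢ windows (T.x i) l)).ncard :=
        Set.ncard_le_ncard hsub (Set.toFinite _)
    _ ≤ (Set.univ ×ˢ windows (T.x i) l : Set (Fin (T.h i) × _)).ncard :=
        Set.ncard_image_le (Set.toFinite _)
    _ = _ := by simp [Set.ncard_prod, Set.ncard_univ]

lemma ncard_windows_le {i K n : ℕ} (hm : T.m i = K * T.b i)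
    (hb : 2 * (T.d (i + 1) + 5) ≤ T.b i) (hn : T.h i ≤ n) (hn' : n ≤ T.h (i + 1)) :
    (windows (T.x 0) n).ncard ≤
      ((T.d i + T.d (i + 1)) * (T.d (i + 1) + 6) + 2 * K * T.d (i + 1) ^ 2) * n := by
  have hpos := T.h_pos i
  have hdiv := Nat.div_add_mod n (T.h i)
  have hmod := Nat.mod_lt n hpos
  have hq : 0 < n / T.h i := Nat.div_pos hn hpos
  set q := n / T.h i
  set e := T.d (i + 1)
  by_cases hbq : q + 2 + e + 3 ≤ T.b i
  · have h1 := T.ncard_windows_le_mul i (n := n) (l := q + 2) (by nlinarith)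
    have h2 := (T.good i).card_windows _ _ (T.subst i) (q + 2) (by omega) hbq
    calc (windows (T.x 0) n).ncard ≤ T.h i * ((T.d i + e) * (q + 2 + e + 3)) :=
          h1.trans (Nat.mul_le_mul_left _ h2)
      _ = (T.d i + e) * (T.h i * q + T.h i * (e + 5)) := by ring
      _ ≤ (T.d i + e) * (n + n * (e + 5)) := by gcongr; omega
      _ = (T.d i + e) * (e + 6) * n := by ring
      _ ≤ _ := Nat.mul_le_mul_right _ (Nat.le_add_right _ _)
  · have h1 := T.ncard_windows_le_mul (i + 1) (n := n) (l := 2) (by omega)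
    have h2 : (windows (T.x (i + 1)) 2).ncard ≤ e ^ 2 := by
      have := ncard_le_of_subset_range id (S := windows (T.x (i + 1)) 2) (by simp)
      simpa using this
    have h3 : T.h (i + 1) ≤ 2 * K * n := by
      rw [h_succ, hm]
      have : T.b i ≤ 2 * q := by omega
      calc T.h i * (K * T.b i) ≤ T.h i * (K * (2 * q)) := by gcongr
        _ = 2 * K * (T.h i * q) := by ring
        _ ≤ 2 * K * n := by gcongr; omega
    calc (windows (T.x 0) n).ncard ≤ (2 * K * n) * e ^ 2 := h1.trans (Nat.mul_le_mul h3 h2)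
      _ = 2 * K * e ^ 2 * n := by ring
      _ ≤ _ := Nat.mul_le_mul_right _ (Nat.le_add_left _ _)

lemma exists_level {j n : ℕ} (hj : T.h j ≤ n) : ∃ i ≥ j, T.h i ≤ n ∧ n < T.h (i + 1) := by
  have hjn : j ≤ n := (T.lt_h j).le.trans hj
  refine ⟨Nat.findGreatest (fun i => T.h i ≤ n) n, Nat.le_findGreatest hjn hj,
    Nat.findGreatest_spec (P := fun i => T.h i ≤ n) hjn hj, ?_⟩
  by_contra! hc
  have h1 := (T.lt_h _).le.trans hc
  have := Nat.le_findGreatest (P := fun i => T.h i ≤ n) h1 hc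
  omega

end Tower

end DimToeplitz

theorem theorem3 {G : Type*} [AddCommGroup G] (P : Set G) (u : G)
    (hG : DimToeplitz.IsSimpleDimensionGroupWithUnit G P u)
    (hdiv : ∀ (g : G) (k : ℕ), 1 ≤ k → ∃ h : G, k • h = g)
    (p : ℕ → ℝ) (hpos : ∀ n, 0 < p n)
    (hp : Filter.Tendsto (fun n : ℕ => (n : ℝ) / p n) Filter.atTop (nhds 0)) :
    ∃ (a : ℕ) (Y : SymbolicDynamics.FullShift.Subshift (Fin a) ℤ),
      DimToeplitz.IsMinimalSystem (DimToeplitz.shiftHomeo Y) ∧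
      DimToeplitz.IsToeplitzSubshift Y ∧
      DimToeplitz.OrderedGroupIso
        (DimToeplitz.dynHPos (DimToeplitz.shiftHomeo Y))
        (DimToeplitz.dynHUnit (DimToeplitz.shiftHomeo Y)) P u ∧
      Filter.Tendsto (fun n : ℕ => (DimToeplitz.complexity Y n : ℝ) / p n)
        Filter.atTop (nhds 0) := by
  classical
  obtain ⟨d, K, hd, hK, hpres⟩ := DimToeplitz.exists_balanced_presentation hG hdiv
  let C : ℕ → ℕ := fun i => (d i + d (i + 1)) * (d (i + 1) + 6) + 2 * K i * d (i + 1) ^ 2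
  have hthr : ∀ i, ∃ N : ℕ, ∀ n ≥ N, (C i : ℝ) * (n / p n) < 1 / (i + 1) := fun i => by
    have := (hp.const_mul (C i : ℝ)).eventually_lt_const
      (u := 1 / ((i : ℝ) + 1)) (by rw [mul_zero]; positivity)
    exact Filter.eventually_atTop.1 this
  choose N hN using hthr
  let t : ℕ → ℕ := fun i => max (2 * (d (i + 1) + 5)) (N (i + 1))
  have ht : ∀ i, 2 * (d (i + 1) + 5) ≤ t i := fun i => le_max_left _ _
  obtain ⟨B, γ, hB, hrow, hγ, hu⟩ := hpres t fun i => by have := ht i; omega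
  choose τ hτ using fun i => DimToeplitz.exists_goodSubstitution (hd i) (B i)
    (b := t i) (by have := ht i; omega) (hB i) (hrow i)
  have hmt : ∀ i, t i ≤ K i * t i := fun i => Nat.le_mul_of_pos_left _ (hK i)
  have hm : ∀ i, 2 ≤ K i * t i := fun i => by have := ht i; have := hmt i; omega
  let T : DimToeplitz.Tower :=
    { d := d
      m := fun i => K i * t i
      b := t
      B := B
      first := fun i => ⟨0, by have := hd i; omega⟩
      last := fun i => ⟨d i - 1, by have := hd i; omega⟩
      τ := τ
      x := DimToeplitz.levelSeq hm _ _ τ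
      two_le := hm
      B_pos := fun i k l => by have := hB i k l; have := ht i; omega
      good := hτ
      subst := DimToeplitz.isSubstituted_levelSeq hm (fun i => (hτ i).first_eq)
        fun i => (hτ i).last_eq }
  refine ⟨d 0, DimToeplitz.orbitClosure (T.x 0), T.isMinimalSystem, T.isToeplitzSubshift,
    hu ▸ DimToeplitz.Tower.orderedGroupIso (T := T) hγ, ?_⟩
  have hbound : ∀ i n : ℕ, 1 ≤ i → T.h i ≤ n → n < T.h (i + 1) →
      (DimToeplitz.complexity (DimToeplitz.orbitClosure (T.x 0)) n : ℝ) / p n < 1 / (i + 1) := by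
    intro i n hi hn hn'
    have h1 : DimToeplitz.complexity (DimToeplitz.orbitClosure (T.x 0)) n ≤ C i * n := by
      rw [DimToeplitz.complexity, DimToeplitz.languageOfLength_orbitClosure]
      exact T.ncard_windows_le (K := K i) rfl (ht i) hn hn'.le
    have h2 : N i ≤ n := by
      obtain ⟨j, rfl⟩ : ∃ j, i = j + 1 := ⟨i - 1, by omega⟩
      refine ((le_max_right _ _).trans (hmt j)).trans (le_trans ?_ hn)
      rw [T.h_succ]
      exact Nat.le_mul_of_pos_left _ (T.h_pos j)
    refine lt_of_le_of_lt ?_ (hN i n h2)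
    rw [← mul_div_assoc]
    have := hpos n
    gcongr
    exact_mod_cast h1
  rw [Metric.tendsto_atTop]
  intro ε hε
  obtain ⟨j, hj⟩ := exists_nat_one_div_lt hε
  refine ⟨T.h (j + 1), fun n hn => ?_⟩
  obtain ⟨i, hij, h1, h2⟩ := T.exists_level hn
  have h3 := hbound i n (by omega) h1 h2
  have h4 : (1 : ℝ) / (i + 1) ≤ 1 / (j + 1) := by
    gcongr
    omega
  rw [Real.dist_eq, sub_zero, abs_of_nonneg (div_nonneg (Nat.cast_nonneg _) (hpos n).le)]
  linarith
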